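/- Proposition 4.1. Let $\mathcal E$ be a finite dimensional complex Hilbert space and $L^2_+(\mathcal E)=L^2([0,\infty);\mathcal E)$. A function $\Theta$ with values in the operators on $\mathcal E$ is called bi-inner if it is analytic and uniformly bounded in the open right half plane and $\Theta(i\omega)$ is unitary for almost all real $\omega$. Let $V$ and $W$ be rational bi-inner functions and put $R(s)=V(s)W(-\bar s)^*$, so that $R(i\omega)=V(i\omega)W(i\omega)^*$; put $\widetilde\Theta(s)=\Theta(\bar s)^*$. For $S\in\{V,W,\widetilde V,\widetilde W,R\}$ there are an operator $S(\infty)=\lim_{s\to\infty}S(s)$ and an integrable function $r$ on $\mathbb R$, with operator values, such that $S(i\omega)=S(\infty)+\int_{-\infty}^\infty e^{-i\omega t}r(t)\,dt$ for almost all $\omega$, and the Wiener-Hopf operator $$(T_Sf)(t)=S(\infty)f(t)+\int_0^\infty r(t-\tau)f(\tau)\,d\tau\qquad(f\in L^2_+(\mathcal E))$$ is a bounded operator on $L^2_+(\mathcal E)$, uniquely determined by $S$. For $\Theta\in\{V,W\}$ the kernel $r=\theta$ can be taken to vanish on the negative half line, and the Hankel operator $(H_\Theta f)(t)=\int_0^\infty\theta(t+\tau)f(\tau)\,d\tau$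 is a bounded operator on $L^2_+(\mathcal E)$, uniquely determined by $\Theta$. Put $\mathfrak H(\widetilde\Theta)=L^2_+(\mathcal E)\ominus T_{\widetilde\Theta}L^2_+(\mathcal E)$ for $\Theta\in\{V,W\}$; then $H_\Theta^*$ maps $L^2_+(\mathcal E)$ into $\mathfrak H(\widetilde\Theta)$. Let $Y=P_{\mathfrak H(\widetilde V)}|\mathfrak H(\widetilde W)$, a contraction from $\mathfrak H(\widetilde W)$ into $\mathfrak H(\widetilde V)$. Then $$T_R=T_VT_W^*+H_VYH_W^*,$$ and the following hold. 1. $T_R$ is (boundedly) invertible if and only if $Y$ is invertible. In this case $T_R^{-1}=T_WT_V^*+H_WY^{-1}H_V^*$. 2. $\ker T_R$ and $\ker Y$ have the same dimension. In fact $\ker T_R=H_W\ker Y$ and $\ker Y=\operatorname{im}T_{\widetilde V}\cap\mathfrak H(\widetilde W)$. 3. $\ker T_R^*$ and $\ker Y^*$ have the same dimension. In fact $\ker T_R^*=H_V\ker Y^*$ and $\ker Y^*=\operatorname{im}T_{\widetilde W}\cap\mathfrak H(\widetilde V)$. 4. $(\operatorname{im}T_R)^\perp$ and $(\operatorname{im}Y)^\perp$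 have the same dimension. In fact $(\operatorname{im}T_R)^\perp=\ker T_R^*=H_V\ker Y^*=H_V(\operatorname{im}Y)^\perp$. 5. Say that an operator $T$ admits a Moore-Penrose inverse if $T|(\ker T)^\perp$, as an operator onto $\operatorname{im}T$, is boundedly invertible, and then put $T^{pinv}=(T|(\ker T)^\perp)^{-1}P_{\operatorname{im}T}$. Then $T_R$ admits a Moore-Penrose inverse if and only if $Y$ does, and in this case $T_R^{pinv}=T_WT_V^*+H_WY^{pinv}H_V^*$. -/

import Mathlib

open MeasureTheory Filter Topology Set
open scoped ComplexConjugate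

noncomputable section

namespace WienerHopf

variable {E : Type*} [NormedAddCommGroup E] [InnerProductSpace ℂ E]

/-- Lebesgue measure on the half line `[0, ∞)` (the point `0` is a null set). -/
abbrev halfLine : Measure ℝ := volume.restrict (Ioi (0 : ℝ))

/-- `L²₊(E)`: square integrable functions from the half line to `E`. -/
abbrev L2Plus (E : Type*) [NormedAddCommGroup E] : Type _ := Lp E 2 halfLine

/-- `Θ` is a rational operator valued function: a polynomial with operator coefficients divided by
a nonzero scalar polynomial `q`. The values at the zeros of `q` are left free. -/
def IsRational (Θ : ℂ → E →L[ℂ] E) : Prop :=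
  ∃ (q : Polynomial ℂ) (P : Polynomial (E →L[ℂ] E)), q ≠ 0 ∧
    ∀ s : ℂ, q.eval s ≠ 0 → Θ s = (q.eval s)⁻¹ • P.eval (algebraMap ℂ (E →L[ℂ] E) s)

/-- `Θ` is bi-inner in the right half plane: analytic and uniformly bounded there, with unitary
values almost everywhere on the imaginary axis. -/
structure IsBiInner [CompleteSpace E] (Θ : ℂ → E →L[ℂ] E) : Prop where
  analytic : DifferentiableOn ℂ Θ {s : ℂ | 0 < s.re}
  bounded : ∃ M : ℝ, ∀ s : ℂ, 0 < s.re → ‖Θ s‖ ≤ M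
  unitary_boundary : ∀ᵐ ω : ℝ, Θ (ω * Complex.I) ∈ unitary (E →L[ℂ] E)

/-- `Θ̃(s) = Θ(s̄)*`. -/
def tilde [CompleteSpace E] (Θ : ℂ → E →L[ℂ] E) : ℂ → E →L[ℂ] E :=
  fun s => ContinuousLinearMap.adjoint (Θ (conj s))

/-- `Θ*(s) = Θ(-s̄)*`, so that `Θ*(iω) = Θ(iω)*`. -/
def para [CompleteSpace E] (Θ : ℂ → E →L[ℂ] E) : ℂ → E →L[ℂ] E :=
  fun s => ContinuousLinearMap.adjoint (Θ (-conj s))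

/-- The function `R = V W*`. -/
def symbolVW [CompleteSpace E] (V W : ℂ → E →L[ℂ] E) : ℂ → E →L[ℂ] E :=
  fun s => V s ∘L para W s

/-- `R(∞) = D` and `R(iω) = R(∞) + ∫ e^{-iωt} r(t) dt` with `r` integrable. -/
structure IsSymbolKernel (R : ℂ → E →L[ℂ] E) (D : E →L[ℂ] E) (r : ℝ → E →L[ℂ] E) : Prop where
  tendsto_infty : Tendsto R (Bornology.cobounded ℂ) (𝓝 D)
  integrable : Integrable r
  symbol_eq : ∀ᵐ ω : ℝ, R (ω * Complex.I) =
    D + ∫ t : ℝ, Complex.exp (-(ω * Complex.I) * t) • r t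

/-- `T` is the Wiener-Hopf operator with symbol `R`:
`(T f)(t) = R(∞) f(t) + ∫₀^∞ r(t - τ) f(τ) dτ`.
(If `r` vanishes on the negative half line, the integral runs over `[0, t]`.) -/
def IsWienerHopfOperator (R : ℂ → E →L[ℂ] E) (T : L2Plus E →L[ℂ] L2Plus E) : Prop :=
  ∃ (D : E →L[ℂ] E) (r : ℝ → E →L[ℂ] E), IsSymbolKernel R D r ∧
    ∀ f : L2Plus E, ∀ᵐ t ∂halfLine,
      (T f : ℝ → E) t = D ((f : ℝ → E) t) + ∫ τ in Ioi (0 : ℝ), r (t - τ) ((f : ℝ → E) τ)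

/-- `H` is the Hankel operator of `Θ`: `Θ = Θ(∞) + 𝔏 θ` with `θ` an integrable function on the
half line (extended by `0` to the negative axis), and `(H f)(t) = ∫₀^∞ θ(t + τ) f(τ) dτ`. -/
def IsHankelOperator (Θ : ℂ → E →L[ℂ] E) (H : L2Plus E →L[ℂ] L2Plus E) : Prop :=
  ∃ (D : E →L[ℂ] E) (θ : ℝ → E →L[ℂ] E), IsSymbolKernel Θ D θ ∧ (∀ t < 0, θ t = 0) ∧
    ∀ f : L2Plus E, ∀ᵐ t ∂halfLine,
      (H f : ℝ → E) t = ∫ τ in Ioi (0 : ℝ), θ (t + τ) ((f : ℝ → E) τ)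

/-- The Wiener-Hopf operator `T_R`: the operator singled out by `IsWienerHopfOperator R`. -/
def wienerHopf (R : ℂ → E →L[ℂ] E) : L2Plus E →L[ℂ] L2Plus E :=
  Classical.epsilon (IsWienerHopfOperator R)

/-- The Hankel operator `H_Θ`: the operator singled out by `IsHankelOperator Θ`. -/
def hankel (Θ : ℂ → E →L[ℂ] E) : L2Plus E →L[ℂ] L2Plus E :=
  Classical.epsilon (IsHankelOperator Θ)

/-- `𝔥(Θ) = L²₊(E) ⊖ T_Θ L²₊(E)`. -/
def modelSpace (Θ : ℂ → E →L[ℂ] E) : Submodule ℂ (L2Plus E) :=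
  (LinearMap.range (wienerHopf Θ).toLinearMap)ᗮ

instance [CompleteSpace E] (Θ : ℂ → E →L[ℂ] E) : CompleteSpace (modelSpace Θ) :=
  (Submodule.isClosed_orthogonal _).completeSpace_coe

/-- `H_Θ` restricted to `𝔥(Θ̃)`. -/
def hankelRes [CompleteSpace E] (Θ : ℂ → E →L[ℂ] E) : modelSpace (tilde Θ) →L[ℂ] L2Plus E :=
  hankel Θ ∘L (modelSpace (tilde Θ)).subtypeL

/-- `H_Θ*` as an operator into `𝔥(Θ̃)` (which contains the range of `H_Θ*` when `Θ` is rational and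
bi-inner). -/
def hankelAdj [CompleteSpace E] (Θ : ℂ → E →L[ℂ] E) : L2Plus E →L[ℂ] modelSpace (tilde Θ) :=
  (modelSpace (tilde Θ)).orthogonalProjectionOnto ∘L ContinuousLinearMap.adjoint (hankel Θ)

/-- `Y = P_{𝔥(Ṽ)} | 𝔥(W̃)`. -/
def compressY [CompleteSpace E] (V W : ℂ → E →L[ℂ] E) :
    modelSpace (tilde W) →L[ℂ] modelSpace (tilde V) :=
  (modelSpace (tilde V)).orthogonalProjectionOnto ∘L (modelSpace (tilde W)).subtypeL

section MoorePenrose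

variable {X Z : Type*} [NormedAddCommGroup X] [InnerProductSpace ℂ X]
  [NormedAddCommGroup Z] [InnerProductSpace ℂ Z]

/-- `T | ker(T)ᗮ`, as an operator from `ker(T)ᗮ` to the range of `T`. -/
def restrictKerPerp (T : X →L[ℂ] Z) :
    (LinearMap.ker T.toLinearMap)ᗮ →L[ℂ] LinearMap.range T.toLinearMap :=
  (T ∘L (LinearMap.ker T.toLinearMap)ᗮ.subtypeL).codRestrict (LinearMap.range T.toLinearMap)
    (fun x => ⟨x, rfl⟩)

/-- `T` admits a Moore-Penrose inverse: `T | ker(T)ᗮ` is (boundedly) invertible as an operator onto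
the range of `T`. -/
def HasMoorePenrose (T : X →L[ℂ] Z) : Prop := (restrictKerPerp T).IsInvertible

theorem HasMoorePenrose.completeSpace_range [CompleteSpace X] {T : X →L[ℂ] Z}
    (h : HasMoorePenrose T) : CompleteSpace (LinearMap.range T.toLinearMap) := by
  obtain ⟨e, -⟩ := h
  have : CompleteSpace ((LinearMap.ker T.toLinearMap)ᗮ : Submodule ℂ X) :=
    (Submodule.isClosed_orthogonal _).completeSpace_coe
  exact (completeSpace_congr (e := e.toLinearEquiv.toEquiv) e.isUniformEmbedding).1 this

/-- The Moore-Penrose inverse `(T | ker(T)ᗮ)⁻¹ P_{im T}`. -/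
def moorePenrose [CompleteSpace X] (T : X →L[ℂ] Z) (h : HasMoorePenrose T) : Z →L[ℂ] X :=
  haveI := h.completeSpace_range
  (LinearMap.ker T.toLinearMap)ᗮ.subtypeL ∘L (restrictKerPerp T).inverse ∘L
    (LinearMap.range T.toLinearMap).orthogonalProjectionOnto

end MoorePenrose

end WienerHopf

end

/-!
On `L²(ℝ; E)` a symbol `S` acts by its Laurent operator `L_S`, which the Fourier transform turns
into multiplication by `S(iω)`. Hence `L_V L_W* = L_{VW*}`, and `L_V` is unitary if `V(iω)` is
unitary for almost all `ω`. When `S` has an integrable kernel, `L_S` is convolution with it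
(`IsSymbolKernel.laurent_ae_eq`), so with `J` the reflection and `P` the restriction to the half
line, `T_S = P L_S P*` and `H_S = P L_S J P*`. As these compressions depend on `S` alone, the
Wiener-Hopf and Hankel operators are unique.

Since `P* P + J P* P J = 1`, inserting this between two Laurent operators
(`restrict_comp_extend`) gives
`T_{VW*} = T_V T_W* + H_V H_W*`, `T_V T_V* + H_V H_V* = 1` and `H_V* H_V + T_Ṽ T_Ṽ* = 1`.
The kernels of `V` and `Ṽ` live on the positive half line, so `T_V` and `T_Ṽ` are isometries.
Together these identities say that the row `U_V = [T_V H_V]` is unitary from `L²₊(E) ⊕ 𝔥(Ṽ)` to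
`L²₊(E)` (`isUnitaryRow_of_complementary`), and that `T_R = U_V diag(1, Y) U_W*`
(`wienerHopf_symbolVW_eq_dilate`). Every assertion about invertibility, kernels, ranges and
Moore-Penrose inverses is then read off from this factorization; for the Moore-Penrose inverses
through their characterization by the Penrose equations.

The existence of kernels is a statement about rational functions bounded in the right half plane
(`IsRational.hasCausalKernel`): zeros of the denominator in the closed right half plane cancel, and
the remaining poles are split off one at a time, using that functions with an integrable kernel
form an algebra containing `(s - a)⁻¹` for `Re a < 0`.
-/

noncomputable section

namespace WienerHopf

section HilbertSpace

open ContinuousLinearMap InnerProductSpace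

/-! ### Moore-Penrose inverses -/

section Penrose

variable {X Z : Type*} [NormedAddCommGroup X] [InnerProductSpace ℂ X] [CompleteSpace X]
  [NormedAddCommGroup Z] [InnerProductSpace ℂ Z] [CompleteSpace Z]

/-- The four Penrose equations, stating that `G` is the Moore-Penrose inverse of `T`. -/
structure IsPenroseInverse (T : X →L[ℂ] Z) (G : Z →L[ℂ] X) : Prop where
  apply_inv_apply : T ∘L G ∘L T = T
  inv_apply_inv : G ∘L T ∘L G = G
  adjoint_range : adjoint (T ∘L G) = T ∘L G
  adjoint_corange : adjoint (G ∘L T) = G ∘L T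

theorem IsPenroseInverse.unique {T : X →L[ℂ] Z} {G G' : Z →L[ℂ] X} (h : IsPenroseInverse T G)
    (h' : IsPenroseInverse T G') : G = G' := by
  have hr : T ∘L G = T ∘L G' := by
    calc T ∘L G = adjoint (T ∘L G) := h.adjoint_range.symm
      _ = adjoint ((T ∘L G') ∘L (T ∘L G)) := by
        congr 1
        calc T ∘L G = (T ∘L G' ∘L T) ∘L G := by rw [h'.apply_inv_apply]
          _ = _ := rfl
      _ = (T ∘L G) ∘L (T ∘L G') := by
        rw [adjoint_comp, h.adjoint_range, h'.adjoint_range]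
      _ = (T ∘L G ∘L T) ∘L G' := rfl
      _ = _ := by rw [h.apply_inv_apply]
  have hc : G ∘L T = G' ∘L T := by
    calc G ∘L T = adjoint (G ∘L T) := h.adjoint_corange.symm
      _ = adjoint ((G ∘L T) ∘L (G' ∘L T)) := by
        congr 1
        calc G ∘L T = G ∘L (T ∘L G' ∘L T) := by rw [h'.apply_inv_apply]
          _ = _ := rfl
      _ = (G' ∘L T) ∘L (G ∘L T) := by
        rw [adjoint_comp, h.adjoint_corange, h'.adjoint_corange]
      _ = G' ∘L (T ∘L G ∘L T) := rfl
      _ = _ := by rw [h.apply_inv_apply]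
  calc G = (G ∘L T) ∘L G := h.inv_apply_inv.symm
    _ = G' ∘L (T ∘L G) := by rw [hc]; rfl
    _ = G' ∘L T ∘L G' := by rw [hr]
    _ = G' := h'.inv_apply_inv

omit [CompleteSpace Z] in
theorem apply_moorePenrose {T : X →L[ℂ] Z} (h : HasMoorePenrose T) (z : Z) :
    haveI := h.completeSpace_range
    T (moorePenrose T h z) = (LinearMap.range T.toLinearMap).starProjection z := by
  have := h.completeSpace_range
  have h1 := congrArg Subtype.val (h.self_apply_inverse
    ((LinearMap.range T.toLinearMap).orthogonalProjectionOnto z))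
  exact h1

omit [CompleteSpace Z] in
theorem moorePenrose_apply {T : X →L[ℂ] Z} (h : HasMoorePenrose T) (x : X) :
    moorePenrose T h (T x) = (LinearMap.ker T.toLinearMap)ᗮ.starProjection x := by
  have := h.completeSpace_range
  have h1 : (LinearMap.range T.toLinearMap).orthogonalProjectionOnto (T x) =
      restrictKerPerp T ((LinearMap.ker T.toLinearMap)ᗮ.orthogonalProjectionOnto x) := by
    have h2 : x - (LinearMap.ker T.toLinearMap)ᗮ.starProjection x ∈
        LinearMap.ker T.toLinearMap := by
      have hc : IsClosed (LinearMap.ker T.toLinearMap : Set X) := T.isClosed_ker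
      have := Submodule.sub_starProjection_mem_orthogonal (K := (LinearMap.ker T.toLinearMap)ᗮ) x
      rwa [Submodule.orthogonal_orthogonal_eq_closure, hc.submodule_topologicalClosure_eq] at this
    have h3 : T x = T ((LinearMap.ker T.toLinearMap)ᗮ.starProjection x) := by
      rw [LinearMap.mem_ker, map_sub, sub_eq_zero] at h2
      exact h2
    have h4 := Submodule.orthogonalProjectionOnto_mem_subspace_eq_self
      (K := LinearMap.range T.toLinearMap) ⟨T x, x, rfl⟩
    exact h4.trans (Subtype.ext h3)
  change (((restrictKerPerp T).inverse ((LinearMap.range T.toLinearMap).orthogonalProjectionOnto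
    (T x)) : _) : X) = _
  rw [h1, h.inverse_apply_self]
  rfl

omit [CompleteSpace Z] in
theorem moorePenrose_mem {T : X →L[ℂ] Z} (h : HasMoorePenrose T) (z : Z) :
    moorePenrose T h z ∈ (LinearMap.ker T.toLinearMap)ᗮ := Subtype.property _

theorem isPenroseInverse_moorePenrose {T : X →L[ℂ] Z} (h : HasMoorePenrose T) :
    IsPenroseInverse T (moorePenrose T h) := by
  have := h.completeSpace_range
  have hr : T ∘L moorePenrose T h = (LinearMap.range T.toLinearMap).starProjection :=
    ContinuousLinearMap.ext (apply_moorePenrose h)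
  have hc : moorePenrose T h ∘L T = (LinearMap.ker T.toLinearMap)ᗮ.starProjection :=
    ContinuousLinearMap.ext (moorePenrose_apply h)
  refine ⟨?_, ?_, ?_, ?_⟩
  · ext x
    change T (moorePenrose T h (T x)) = T x
    rw [apply_moorePenrose h]
    exact Submodule.starProjection_eq_self_iff.2 ⟨x, rfl⟩
  · ext z
    change moorePenrose T h (T (moorePenrose T h z)) = _
    rw [moorePenrose_apply h]
    exact Submodule.starProjection_eq_self_iff.2 (moorePenrose_mem h z)
  · rw [hr]
    exact (isSelfAdjoint_starProjection _).adjoint_eq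
  · rw [hc]
    exact (isSelfAdjoint_starProjection _).adjoint_eq

theorem IsPenroseInverse.hasMoorePenrose {T : X →L[ℂ] Z} {G : Z →L[ℂ] X}
    (h : IsPenroseInverse T G) : HasMoorePenrose T := by
  have hGT : ∀ x, T (G (T x)) = T x := fun x => congrArg (fun L => L x) h.apply_inv_apply
  have hTG : ∀ x, G (T (G x)) = G x := fun x => congrArg (fun L => L x) h.inv_apply_inv
  have hmem : ∀ z, G z ∈ (LinearMap.ker T.toLinearMap)ᗮ := by
    intro z x hx
    have hx : T x = 0 := hx
    have h2 : G z = adjoint (G ∘L T) (G z) := by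
      rw [h.adjoint_corange]; exact (hTG z).symm
    rw [h2, adjoint_inner_right]
    simp [hx]
  refine IsInvertible.of_inverse (g := (G ∘L (LinearMap.range T.toLinearMap).subtypeL).codRestrict
    (LinearMap.ker T.toLinearMap)ᗮ fun z => hmem _) ?_ ?_
  · ext ⟨_, x, rfl⟩
    exact hGT x
  · ext ⟨x, hx⟩
    change G (T x) = x
    have h1 : G (T x) - x ∈ LinearMap.ker T.toLinearMap := by
      change T (G (T x) - x) = 0
      rw [map_sub, hGT, sub_self]
    have h2 := Submodule.sub_mem _ (hmem (T x)) hx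
    have h3 := h2 _ h1
    rw [inner_self_eq_zero, sub_eq_zero] at h3
    exact h3

end Penrose

/-! ### Unitary row operators -/

section UnitaryRow

variable {K M N : Type*} [NormedAddCommGroup K] [InnerProductSpace ℂ K] [CompleteSpace K]
  [NormedAddCommGroup M] [InnerProductSpace ℂ M] [CompleteSpace M]
  [NormedAddCommGroup N] [InnerProductSpace ℂ N] [CompleteSpace N]

/-- The row operator `[T A] : K ⊕ M → K` is unitary. -/
structure IsUnitaryRow (T : K →L[ℂ] K) (A : M →L[ℂ] K) : Prop where
  adjoint_left_left : ∀ x, adjoint T (T x) = x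
  adjoint_right_right : ∀ y, adjoint A (A y) = y
  adjoint_left_right : ∀ y, adjoint T (A y) = 0
  adjoint_right_left : ∀ x, adjoint A (T x) = 0
  row_adjoint : ∀ x, T (adjoint T x) + A (adjoint A x) = x

namespace IsUnitaryRow

theorem injective {T : K →L[ℂ] K} {A : M →L[ℂ] K} (h : IsUnitaryRow T A) :
    Function.Injective A :=
  Function.LeftInverse.injective h.adjoint_right_right

variable {T : K →L[ℂ] K} {A : M →L[ℂ] K} {T' : K →L[ℂ] K} {A' : N →L[ℂ] K}
  (h : IsUnitaryRow T A) (h' : IsUnitaryRow T' A') (Y : N →L[ℂ] M)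

/-- The operator `T T'* + A Y A'*`, that is `[T A] diag(1, Y) [T' A']*`. -/
def dilate (T : K →L[ℂ] K) (A : M →L[ℂ] K) (T' : K →L[ℂ] K) (A' : N →L[ℂ] K) (Y : N →L[ℂ] M) :
    K →L[ℂ] K := T ∘L adjoint T' + A ∘L Y ∘L adjoint A'

omit [CompleteSpace M] in
theorem dilate_apply (x : K) :
    dilate T A T' A' Y x = T (adjoint T' x) + A (Y (adjoint A' x)) := rfl

theorem adjoint_dilate : adjoint (dilate T A T' A' Y) = dilate T' A' T A (adjoint Y) := by
  simp [dilate, adjoint_comp, ContinuousLinearMap.comp_assoc]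

include h in
theorem dilate_id : dilate T A T A (ContinuousLinearMap.id ℂ M) = ContinuousLinearMap.id ℂ K :=
  ContinuousLinearMap.ext h.row_adjoint

omit [CompleteSpace M] in
include h' in
theorem dilate_comp {P : Type*} [NormedAddCommGroup P] [InnerProductSpace ℂ P] [CompleteSpace P]
    {T'' : K →L[ℂ] K} {A'' : P →L[ℂ] K} (Z : P →L[ℂ] N) :
    dilate T A T' A' Y ∘L dilate T' A' T'' A'' Z = dilate T A T'' A'' (Y ∘L Z) := by
  ext x
  simp [dilate_apply, h'.adjoint_left_left, h'.adjoint_left_right, h'.adjoint_right_left,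
    h'.adjoint_right_right]

omit [CompleteSpace M] in
include h' in
theorem dilate_left (x : K) : dilate T A T' A' Y (T' x) = T x := by
  simp [dilate_apply, h'.adjoint_left_left, h'.adjoint_right_left]

omit [CompleteSpace M] in
include h' in
theorem dilate_right (y : N) : dilate T A T' A' Y (A' y) = A (Y y) := by
  simp [dilate_apply, h'.adjoint_left_right, h'.adjoint_right_right]

include h in
theorem adjoint_right_dilate (x : K) :
    adjoint A (dilate T A T' A' Y x) = Y (adjoint A' x) := by
  simp [dilate_apply, h.adjoint_right_left, h.adjoint_right_right]

include h in
theorem adjoint_left_dilate (x : K) :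
    adjoint T (dilate T A T' A' Y x) = adjoint T' x := by
  simp [dilate_apply, h.adjoint_left_left, h.adjoint_left_right]

include h h' in
theorem dilate_inverse {Z : M →L[ℂ] N} (h1 : Y ∘L Z = ContinuousLinearMap.id ℂ M)
    (h2 : Z ∘L Y = ContinuousLinearMap.id ℂ N) :
    (dilate T A T' A' Y).IsInvertible ∧ (dilate T A T' A' Y).inverse = dilate T' A' T A Z := by
  have e1 : dilate T A T' A' Y ∘L dilate T' A' T A Z = ContinuousLinearMap.id ℂ K := by
    rw [h'.dilate_comp, h1, h.dilate_id]
  have e2 : dilate T' A' T A Z ∘L dilate T A T' A' Y = ContinuousLinearMap.id ℂ K := by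
    rw [h.dilate_comp, h2, h'.dilate_id]
  exact ⟨IsInvertible.of_inverse e1 e2, inverse_eq e1 e2⟩

include h h' in
theorem dilate_isInvertible_iff : (dilate T A T' A' Y).IsInvertible ↔ Y.IsInvertible := by
  constructor
  · intro hR
    set R := dilate T A T' A' Y with hRdef
    refine IsInvertible.of_inverse (g := adjoint A' ∘L R.inverse ∘L A) ?_ ?_
    · ext y
      have h1 : Y (adjoint A' (R.inverse (A y))) = adjoint A (R (R.inverse (A y))) :=
        (h.adjoint_right_dilate Y _).symm
      change Y (adjoint A' (R.inverse (A y))) = y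
      rw [h1, hR.self_apply_inverse, h.adjoint_right_right]
    · ext y
      change adjoint A' (R.inverse (A (Y y))) = y
      rw [← h'.dilate_right (T := T) (A := A) Y y, ← hRdef, hR.inverse_apply_self,
        h'.adjoint_right_right]
  · rintro ⟨e, rfl⟩
    exact (h.dilate_inverse h' _ (Z := e.symm) (by ext; simp) (by ext; simp)).1

include h h' in
theorem dilate_inverse_of_isInvertible (hY : Y.IsInvertible) :
    (dilate T A T' A' Y).inverse = dilate T' A' T A Y.inverse := by
  refine (h.dilate_inverse h' Y ?_ ?_).2
  · ext y; exact hY.self_apply_inverse y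
  · ext y; exact hY.inverse_apply_self y

include h h' in
theorem ker_dilate : LinearMap.ker (dilate T A T' A' Y).toLinearMap =
    (LinearMap.ker Y.toLinearMap).map A'.toLinearMap := by
  ext x
  rw [LinearMap.mem_ker, Submodule.mem_map]
  constructor
  · intro hx
    have hx : dilate T A T' A' Y x = 0 := hx
    refine ⟨adjoint A' x, ?_, ?_⟩
    · change Y (adjoint A' x) = 0
      rw [← h.adjoint_right_dilate, hx, map_zero]
    · have h1 : adjoint T' x = 0 := by rw [← h.adjoint_left_dilate Y, hx, map_zero]
      have h2 := h'.row_adjoint x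
      rwa [h1, map_zero, zero_add] at h2
  · rintro ⟨y, hy, rfl⟩
    have hy : Y y = 0 := hy
    change dilate T A T' A' Y (A' y) = 0
    rw [h'.dilate_right, hy, map_zero]

include h h' in
theorem isPenroseInverse_dilate {Z : M →L[ℂ] N} (hZ : IsPenroseInverse Y Z) :
    IsPenroseInverse (dilate T A T' A' Y) (dilate T' A' T A Z) where
  apply_inv_apply := by
    rw [h.dilate_comp, h'.dilate_comp, hZ.apply_inv_apply]
  inv_apply_inv := by
    rw [h'.dilate_comp, h.dilate_comp, hZ.inv_apply_inv]
  adjoint_range := by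
    rw [h'.dilate_comp, adjoint_dilate, hZ.adjoint_range]
  adjoint_corange := by
    rw [h.dilate_comp, adjoint_dilate, hZ.adjoint_corange]

include h h' in
theorem isPenroseInverse_compress {G : K →L[ℂ] K}
    (hG : IsPenroseInverse (dilate T A T' A' Y) G) :
    IsPenroseInverse Y (adjoint A' ∘L G ∘L A) := by
  set R := dilate T A T' A' Y with hR
  have hYB : Y ∘L adjoint A' = adjoint A ∘L R :=
    ContinuousLinearMap.ext fun x => (h.adjoint_right_dilate Y x).symm
  have hAY : A ∘L Y = R ∘L A' :=
    ContinuousLinearMap.ext fun x => (h'.dilate_right Y x).symm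
  have hBA : adjoint A ∘L A = ContinuousLinearMap.id ℂ M :=
    ContinuousLinearMap.ext h.adjoint_right_right
  have e1 : Y ∘L (adjoint A' ∘L G ∘L A) = adjoint A ∘L (R ∘L G) ∘L A := by
    rw [← ContinuousLinearMap.comp_assoc, hYB]; rfl
  have e2 : (adjoint A' ∘L G ∘L A) ∘L Y = adjoint A' ∘L (G ∘L R) ∘L A' := by
    change adjoint A' ∘L G ∘L (A ∘L Y) = _
    rw [hAY]; rfl
  -- `G R` is the projection onto the orthogonal complement of `ker R`, which contains `T' K`.
  have hGRT : ∀ x, G (R (T' x)) = T' x := by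
    have hT' : ∀ x, adjoint R (T x) = T' x := fun x => by
      rw [hR, adjoint_dilate, h.dilate_left]
    intro x
    have h1 : (G ∘L R) ∘L adjoint R = adjoint R := by
      rw [← hG.adjoint_corange, ← adjoint_comp, hG.apply_inv_apply]
    rw [← hT' x]
    exact congrArg (fun L => L (T x)) h1
  refine ⟨?_, ?_, ?_, ?_⟩
  · rw [e2, ← ContinuousLinearMap.comp_assoc, hYB]
    change adjoint A ∘L (R ∘L G ∘L R) ∘L A' = Y
    rw [hG.apply_inv_apply, ← hAY, ← ContinuousLinearMap.comp_assoc, hBA]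
    rfl
  · ext y
    rw [e1]
    change adjoint A' (G (A (adjoint A (R (G (A y)))))) = adjoint A' (G (A y))
    have h1 := h.row_adjoint (R (G (A y)))
    have h2 : adjoint T (R (G (A y))) = adjoint T' (G (A y)) := h.adjoint_left_dilate Y _
    rw [h2, ← h'.dilate_left (T := T) (A := A) Y, ← hR] at h1
    have h3 : A (adjoint A (R (G (A y)))) = R (G (A y)) - R (T' (adjoint T' (G (A y)))) :=
      eq_sub_of_add_eq' h1
    have h4 : G (R (G (A y))) = G (A y) := congrArg (fun L => L (A y)) hG.inv_apply_inv
    rw [h3, map_sub, map_sub, hGRT, h'.adjoint_right_left, sub_zero, h4]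
  · rw [e1, adjoint_comp, adjoint_comp, hG.adjoint_range, adjoint_adjoint]
    rfl
  · rw [e2, adjoint_comp, adjoint_comp, hG.adjoint_corange, adjoint_adjoint]
    rfl

include h h' in
theorem hasMoorePenrose_dilate_iff : HasMoorePenrose (dilate T A T' A' Y) ↔ HasMoorePenrose Y :=
  ⟨fun hR => (h.isPenroseInverse_compress h' Y (isPenroseInverse_moorePenrose hR)).hasMoorePenrose,
    fun hY => (h.isPenroseInverse_dilate h' Y (isPenroseInverse_moorePenrose hY)).hasMoorePenrose⟩

include h h' in
theorem moorePenrose_dilate (hR : HasMoorePenrose (dilate T A T' A' Y)) (hY : HasMoorePenrose Y) :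
    moorePenrose (dilate T A T' A' Y) hR = dilate T' A' T A (moorePenrose Y hY) :=
  (isPenroseInverse_moorePenrose hR).unique
    (h.isPenroseInverse_dilate h' Y (isPenroseInverse_moorePenrose hY))

end IsUnitaryRow

/-- If `T` and `S` are isometries, `T T* + H H* = 1` and `H* H + S S* = 1`, then `[T H]` is
unitary as an operator on `K ⊕ (S K)ᗮ`. -/
theorem isUnitaryRow_of_complementary {T H S : K →L[ℂ] K}
    (hT : adjoint T ∘L T = ContinuousLinearMap.id ℂ K)
    (hS : adjoint S ∘L S = ContinuousLinearMap.id ℂ K)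
    (hTH : T ∘L adjoint T + H ∘L adjoint H = ContinuousLinearMap.id ℂ K)
    (hHS : adjoint H ∘L H + S ∘L adjoint S = ContinuousLinearMap.id ℂ K) :
    (∀ x, adjoint H x ∈ (LinearMap.range S.toLinearMap)ᗮ) ∧
      H ∘L (LinearMap.range S.toLinearMap)ᗮ.starProjection = H ∧
      IsUnitaryRow T (H ∘L (LinearMap.range S.toLinearMap)ᗮ.subtypeL) := by
  have hT' : ∀ x, adjoint T (T x) = x := fun x => congrArg (fun L => L x) hT
  have hS' : ∀ x, adjoint S (S x) = x := fun x => congrArg (fun L => L x) hS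
  have hTH' : ∀ x, T (adjoint T x) + H (adjoint H x) = x := fun x => congrArg (fun L => L x) hTH
  have hHS' : ∀ x, adjoint H (H x) + S (adjoint S x) = x := fun x => congrArg (fun L => L x) hHS
  have hHT : ∀ x, adjoint H (T x) = 0 := by
    intro x
    have h1 : H (adjoint H (T x)) = 0 := by
      have := hTH' (T x)
      rw [hT'] at this
      simpa using this
    rw [← inner_self_eq_zero (𝕜 := ℂ), adjoint_inner_left, h1, inner_zero_right]
  have hHS0 : ∀ x, H (S x) = 0 := by
    intro x
    have h1 : adjoint H (H (S x)) = 0 := by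
      have := hHS' (S x)
      rw [hS'] at this
      simpa using this
    rw [← inner_self_eq_zero (𝕜 := ℂ), ← adjoint_inner_left, h1, inner_zero_left]
  have hmem : ∀ x, adjoint H x ∈ (LinearMap.range S.toLinearMap)ᗮ := by
    rintro x _ ⟨y, rfl⟩
    change inner ℂ (S y) _ = 0
    rw [adjoint_inner_right, hHS0, inner_zero_left]
  have hP : H ∘L (LinearMap.range S.toLinearMap)ᗮ.starProjection = H := by
    have : adjoint (H ∘L (LinearMap.range S.toLinearMap)ᗮ.starProjection) = adjoint H := by
      rw [adjoint_comp, (isSelfAdjoint_starProjection _).adjoint_eq]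
      ext1 x
      exact Submodule.starProjection_eq_self_iff.2 (hmem x)
    simpa using congrArg adjoint this
  have hA : adjoint (H ∘L (LinearMap.range S.toLinearMap)ᗮ.subtypeL) =
      (LinearMap.range S.toLinearMap)ᗮ.orthogonalProjectionOnto ∘L adjoint H := by
    rw [adjoint_comp, Submodule.adjoint_subtypeL]
  refine ⟨hmem, hP, hT', ?_, ?_, ?_, ?_⟩
  · rintro ⟨y, hy⟩
    rw [hA]
    have hSy : adjoint S y = 0 := by
      rw [← inner_self_eq_zero (𝕜 := ℂ), adjoint_inner_left, ← inner_conj_symm]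
      exact (congrArg _ (hy _ ⟨adjoint S y, rfl⟩)).trans (map_zero _)
    have h1 : adjoint H (H y) = y := by simpa [hSy] using hHS' y
    change (LinearMap.range S.toLinearMap)ᗮ.orthogonalProjectionOnto (adjoint H (H y)) = _
    rw [h1]
    exact Submodule.orthogonalProjectionOnto_mem_subspace_eq_self (K := _ᗮ) ⟨y, hy⟩
  · intro y
    rw [← inner_self_eq_zero (𝕜 := ℂ), adjoint_inner_left]
    change inner ℂ (H y) _ = 0
    rw [← adjoint_inner_right, hHT, inner_zero_right]
  · intro x
    rw [hA]
    change (LinearMap.range S.toLinearMap)ᗮ.orthogonalProjectionOnto (adjoint H (T x)) = _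
    rw [hHT, map_zero]
  · intro x
    rw [hA]
    change T (adjoint T x) +
      (H ∘L (LinearMap.range S.toLinearMap)ᗮ.starProjection) (adjoint H x) = x
    rw [hP, hTH']

/-- For a subspace `M` and an isometry `S`, the vectors of `M` annihilated by the projection onto
`(S K)ᗮ` are those in `S K`, as `S K` is closed. -/
theorem map_ker_compression {S : K →L[ℂ] K} (hS : adjoint S ∘L S = ContinuousLinearMap.id ℂ K)
    (M : Submodule ℂ K) :
    (LinearMap.ker ((LinearMap.range S.toLinearMap)ᗮ.orthogonalProjectionOnto ∘L
      M.subtypeL).toLinearMap).map M.subtype = LinearMap.range S.toLinearMap ⊓ M := by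
  have hcl : IsClosed (LinearMap.range S.toLinearMap : Set K) := by
    have hiso : Isometry S := AddMonoidHomClass.isometry_of_norm S fun x =>
      (norm_map_iff_adjoint_comp_self S).2 hS x
    have := hiso.isClosedEmbedding.isClosed_range
    rwa [LinearMap.coe_range]
  ext x
  have key : (LinearMap.range S.toLinearMap)ᗮ.orthogonalProjectionOnto x = 0 ↔
      x ∈ LinearMap.range S.toLinearMap := by
    rw [Submodule.orthogonalProjectionOnto_eq_zero_iff,
      Submodule.orthogonal_orthogonal_eq_closure, hcl.submodule_topologicalClosure_eq]
  constructor
  · rintro ⟨y, hy, rfl⟩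
    exact ⟨key.1 hy, y.2⟩
  · rintro ⟨h1, h2⟩
    exact ⟨⟨x, h2⟩, key.2 h1, rfl⟩

end UnitaryRow
end HilbertSpace

section Laurent

open FourierTransform SchwartzMap
open scoped ContDiff Convolution

/-! ### The Fourier transform on `L¹` and on `L²` -/

section Fourier

variable {F : Type*} [NormedAddCommGroup F] [InnerProductSpace ℂ F] [CompleteSpace F]

/-- Square integrable functions on the line. -/
abbrev L2Line (F : Type*) [NormedAddCommGroup F] : Type _ := Lp F 2 (volume : Measure ℝ)

theorem integral_smul_fourier_L2 (φ : 𝓢(ℝ, ℂ)) (h : L2Line F) :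
    ∫ x, φ x • (𝓕 h : L2Line F) x = ∫ x, 𝓕 φ x • h x := by
  have h1 := congrArg (fun T => T φ) (Lp.fourier_toTemperedDistribution_eq h)
  simp only [TemperedDistribution.fourier_apply, Lp.toTemperedDistribution_apply] at h1
  exact h1.symm

theorem integral_smul_fourier_L1 (φ : 𝓢(ℝ, ℂ)) {g : ℝ → F} (hg : Integrable g) :
    ∫ x, φ x • 𝓕 g x = ∫ x, 𝓕 φ x • g x := by
  have := VectorFourier.integral_fourierIntegral_smul_eq_flip (L := innerₗ ℝ)
    (e := Real.fourierChar) (μ := volume) (ν := volume) Real.continuous_fourierChar continuous_inner φ.integrable hg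
  simpa using! this.symm

omit [InnerProductSpace ℂ F] [CompleteSpace F] in
theorem locallyIntegrable_coeFn (h : L2Line F) : LocallyIntegrable h volume :=
  (Lp.memLp h).locallyIntegrable one_le_two

/-- Locally integrable functions are determined by their pairings with Schwartz functions. -/
theorem ae_eq_of_schwartz {f g : ℝ → F} (hf : LocallyIntegrable f) (hg : LocallyIntegrable g)
    (h : ∀ φ : 𝓢(ℝ, ℂ), ∫ x, φ x • f x = ∫ x, φ x • g x) : f =ᵐ[volume] g := by
  refine ae_eq_of_integral_contDiff_smul_eq hf hg fun φ hφ hc => ?_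
  have h1 : HasCompactSupport (Complex.ofRealCLM ∘ φ) := hc.comp_left rfl
  have h2 : ContDiff ℝ ∞ (Complex.ofRealCLM ∘ φ) := by fun_prop
  simpa using h (h1.toSchwartzMap h2)

omit [CompleteSpace F] in
theorem continuous_fourier_of_integrable {g : ℝ → F} (hg : Integrable g) : Continuous (𝓕 g) :=
  VectorFourier.fourierIntegral_continuous Real.continuous_fourierChar
    (by exact continuous_inner) hg

/-- On `L¹ ∩ L²` the two Fourier transforms agree. -/
theorem fourier_toLp_ae_eq {g : ℝ → F} (hg : Integrable g) (hg2 : MemLp g 2) :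
    (𝓕 (hg2.toLp g) : L2Line F) =ᵐ[volume] 𝓕 g := by
  refine ae_eq_of_schwartz (locallyIntegrable_coeFn _)
    (continuous_fourier_of_integrable hg).locallyIntegrable fun φ => ?_
  rw [integral_smul_fourier_L2, integral_smul_fourier_L1 φ hg]
  refine integral_congr_ae ?_
  filter_upwards [hg2.coeFn_toLp] with x hx
  rw [hx]

/-- A square integrable and an integrable function with the same Fourier transform agree. -/
theorem ae_eq_of_fourier_ae_eq {g : ℝ → F} (hg : Integrable g) {h : L2Line F}
    (hgh : (𝓕 h : L2Line F) =ᵐ[volume] 𝓕 g) : h =ᵐ[volume] g := by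
  refine ae_eq_of_schwartz (locallyIntegrable_coeFn _) hg.locallyIntegrable fun φ => ?_
  have h1 := integral_smul_fourier_L2 (𝓕⁻ φ) h
  have h2 := integral_smul_fourier_L1 (𝓕⁻ φ) hg
  rw [FourierTransform.fourier_fourierInv_eq] at h1 h2
  rw [← h1, ← h2]
  refine integral_congr_ae ?_
  filter_upwards [hgh] with x hx
  rw [hx]

end Fourier

/-! ### Multiplication and reflection on the line -/

section Operators

variable {E : Type*} [NormedAddCommGroup E] [InnerProductSpace ℂ E] [CompleteSpace E]

open ContinuousLinearMap

/-- Multiplication by an essentially bounded operator valued function on `L²(ℝ; E)`; the zero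
operator if `σ` is not essentially bounded. -/
def mulOp (σ : ℝ → E →L[ℂ] E) : L2Line E →L[ℂ] L2Line E :=
  open Classical in
  if h : MemLp σ ⊤ (volume : Measure ℝ) then
    (ContinuousLinearMap.id ℂ (E →L[ℂ] E)).holderL volume ⊤ 2 2 (h.toLp σ) else 0

theorem coeFn_mulOp {σ : ℝ → E →L[ℂ] E} (h : MemLp σ ⊤ (volume : Measure ℝ)) (f : L2Line E) :
    mulOp σ f =ᵐ[volume] fun ξ => σ ξ (f ξ) := by
  rw [mulOp, dif_pos h]
  have h1 := (ContinuousLinearMap.id ℂ (E →L[ℂ] E)).coeFn_holder (r := 2) (h.toLp σ) f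
  refine EventuallyEq.trans h1 ?_
  filter_upwards [h.coeFn_toLp] with ξ hξ
  rw [hξ]
  rfl

theorem mulOp_congr {σ σ' : ℝ → E →L[ℂ] E} (hσ : MemLp σ ⊤ (volume : Measure ℝ))
    (h : σ =ᵐ[volume] σ') : mulOp σ = mulOp σ' := by
  ext1 f
  refine Lp.ext ?_
  filter_upwards [coeFn_mulOp hσ f, coeFn_mulOp ((memLp_congr_ae h).1 hσ) f, h] with ξ h1 h2 h3
  rw [h1, h2, h3]

theorem mulOp_one : mulOp (fun _ => ContinuousLinearMap.id ℂ E) = ContinuousLinearMap.id ℂ _ := by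
  ext1 f
  refine Lp.ext ?_
  filter_upwards [coeFn_mulOp (memLp_top_const (ContinuousLinearMap.id ℂ E)) f] with ξ h1
  rw [h1]
  rfl

omit [CompleteSpace E] in
theorem memLp_top_comp {σ σ' : ℝ → E →L[ℂ] E} (h : MemLp σ ⊤ (volume : Measure ℝ))
    (h' : MemLp σ' ⊤ (volume : Measure ℝ)) :
    MemLp (fun ξ => σ ξ ∘L σ' ξ) ⊤ (volume : Measure ℝ) :=
  (h'.mul h : _)

theorem memLp_top_adjoint {σ : ℝ → E →L[ℂ] E} (h : MemLp σ ⊤ (volume : Measure ℝ)) :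
    MemLp (fun ξ => adjoint (σ ξ)) ⊤ (volume : Measure ℝ) :=
  h.of_le ((adjoint (𝕜 := ℂ) (E := E) (F := E)).continuous.comp_aestronglyMeasurable h.1)
    (Eventually.of_forall fun _ => (LinearIsometryEquiv.norm_map _ _).le)

theorem mulOp_comp {σ σ' : ℝ → E →L[ℂ] E} (h : MemLp σ ⊤ (volume : Measure ℝ))
    (h' : MemLp σ' ⊤ (volume : Measure ℝ)) :
    mulOp σ ∘L mulOp σ' = mulOp (fun ξ => σ ξ ∘L σ' ξ) := by
  ext1 f
  refine Lp.ext ?_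
  filter_upwards [coeFn_mulOp h (mulOp σ' f), coeFn_mulOp h' f,
    coeFn_mulOp (memLp_top_comp h h') f] with ξ h1 h2 h3
  rw [h3]
  exact h1.trans (by rw [h2]; rfl)

theorem adjoint_mulOp {σ : ℝ → E →L[ℂ] E} (h : MemLp σ ⊤ (volume : Measure ℝ)) :
    adjoint (mulOp σ) = mulOp (fun ξ => adjoint (σ ξ)) := by
  refine ((eq_adjoint_iff _ _).2 fun f g => ?_).symm
  rw [L2.inner_def, L2.inner_def]
  refine integral_congr_ae ?_
  filter_upwards [coeFn_mulOp h g, coeFn_mulOp (memLp_top_adjoint h) f] with ξ h1 h2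
  rw [h1, h2, adjoint_inner_left]

/-- The Fourier transform of `L²(ℝ; E)` as a unitary operator. -/
abbrev fourierL2 (E : Type*) [NormedAddCommGroup E] [InnerProductSpace ℂ E] [CompleteSpace E] :
    L2Line E ≃ₗᵢ[ℂ] L2Line E := Lp.fourierTransformₗᵢ ℝ E

/-- The reflection `(J f)(t) = f(-t)` on `L²(ℝ; E)`. -/
def reflect (E : Type*) [NormedAddCommGroup E] [InnerProductSpace ℂ E] :
    L2Line E →L[ℂ] L2Line E :=
  (Lp.compMeasurePreservingₗᵢ ℂ Neg.neg (Measure.measurePreserving_neg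
    (volume : Measure ℝ))).toContinuousLinearMap

omit [CompleteSpace E] in
theorem coeFn_reflect (f : L2Line E) : reflect E f =ᵐ[volume] fun t => f (-t) :=
  Lp.coeFn_compMeasurePreserving f (Measure.measurePreserving_neg (volume : Measure ℝ))

theorem ae_neg {p : ℝ → Prop} (h : ∀ᵐ t : ℝ, p t) : ∀ᵐ t : ℝ, p (-t) :=
  (Measure.measurePreserving_neg (volume : Measure ℝ)).quasiMeasurePreserving.ae h

omit [CompleteSpace E] in
theorem reflect_reflect (f : L2Line E) : reflect E (reflect E f) = f := by
  refine Lp.ext ?_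
  filter_upwards [coeFn_reflect (reflect E f), ae_neg (coeFn_reflect f)] with t h1 h2
  rw [h1, h2, neg_neg]

theorem adjoint_reflect : adjoint (reflect E) = reflect E := by
  refine ((eq_adjoint_iff _ _).2 fun f g => ?_).symm
  rw [L2.inner_def, L2.inner_def, ← integral_neg_eq_self]
  refine integral_congr_ae ?_
  filter_upwards [ae_neg (coeFn_reflect f), coeFn_reflect g] with ξ h1 h2
  rw [h1, h2, neg_neg]

/-- `J F = F⁻¹`; it suffices to compare on Schwartz functions. -/
theorem reflect_fourier (f : L2Line E) : reflect E (fourierL2 E f) = (fourierL2 E).symm f := by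
  have h : (fun f => reflect E (fourierL2 E f)) = fun f => (fourierL2 E).symm f := by
    refine (SchwartzMap.denseRange_toLpCLM (E := ℝ) (F := E) (p := 2)
      (μ := volume) ENNReal.ofNat_ne_top).equalizer (by fun_prop) (by fun_prop) ?_
    ext1 φ
    change reflect E (𝓕 (φ.toLp 2) : L2Line E) = 𝓕⁻ (φ.toLp 2)
    rw [SchwartzMap.toLp_fourier_eq, SchwartzMap.toLp_fourierInv_eq]
    refine Lp.ext ?_
    filter_upwards [coeFn_reflect ((𝓕 φ).toLp 2), ae_neg ((𝓕 φ).coeFn_toLp 2 volume),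
      (𝓕⁻ φ).coeFn_toLp 2 volume] with t h1 h2 h3
    rw [h1, h2, h3, SchwartzMap.fourier_coe, SchwartzMap.fourierInv_coe,
      Real.fourierInv_eq_fourier_neg]
  exact congrFun h f

theorem fourier_reflect (f : L2Line E) : fourierL2 E (reflect E f) = (fourierL2 E).symm f := by
  have h1 := reflect_fourier ((fourierL2 E).symm f)
  rw [LinearIsometryEquiv.apply_symm_apply] at h1
  rw [h1, LinearIsometryEquiv.apply_symm_apply]

theorem mulOp_reflect {σ : ℝ → E →L[ℂ] E} (h : MemLp σ ⊤ (volume : Measure ℝ)) (f : L2Line E) :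
    reflect E (mulOp σ (reflect E f)) = mulOp (fun ξ => σ (-ξ)) f := by
  have h' : MemLp (fun ξ => σ (-ξ)) ⊤ (volume : Measure ℝ) :=
    h.comp_measurePreserving (Measure.measurePreserving_neg (volume : Measure ℝ))
  refine Lp.ext ?_
  filter_upwards [coeFn_reflect (mulOp σ (reflect E f)), ae_neg (coeFn_mulOp h (reflect E f)),
    ae_neg (coeFn_reflect f), coeFn_mulOp h' f] with t h1 h2 h3 h4
  rw [h1, h2, h3, h4, neg_neg]

end Operators
end Laurent

section LaurentOperators

/-! ### Symbols and Laurent operators -/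

open FourierTransform ContinuousLinearMap
open scoped Convolution

variable {E : Type*} [NormedAddCommGroup E] [InnerProductSpace ℂ E] [CompleteSpace E]

/-- The boundary function `ξ ↦ S(2πiξ)`. The scaling by `2π` matches the normalization of the
Fourier transform, `𝓕 r ξ = ∫ exp(-2πiξt) r(t) dt`. -/
def axis (S : ℂ → E →L[ℂ] E) : ℝ → E →L[ℂ] E :=
  fun ξ => S ((2 * Real.pi * ξ : ℝ) * Complex.I)

theorem ae_comp_two_pi_mul {p : ℝ → Prop} (h : ∀ᵐ ω : ℝ, p ω) :
    ∀ᵐ ξ : ℝ, p (2 * Real.pi * ξ) := by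
  have h2 : (2 * Real.pi : ℝ) ≠ 0 := by positivity
  have : Measure.QuasiMeasurePreserving (fun ξ : ℝ => 2 * Real.pi * ξ) volume volume := by
    refine ⟨by fun_prop, ?_⟩
    rw [Real.map_volume_mul_left h2]
    exact Measure.smul_absolutelyContinuous
  exact this.ae h

/-- The Laurent operator with symbol `S` on `L²(ℝ; E)`, diagonalized by the Fourier transform. -/
def laurent (S : ℂ → E →L[ℂ] E) : L2Line E →L[ℂ] L2Line E :=
  ((fourierL2 E).symm : L2Line E →L[ℂ] L2Line E) ∘L mulOp (axis S) ∘L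
    (fourierL2 E : L2Line E →L[ℂ] L2Line E)

theorem laurent_apply (S : ℂ → E →L[ℂ] E) (f : L2Line E) :
    laurent S f = (fourierL2 E).symm (mulOp (axis S) (fourierL2 E f)) := rfl

namespace IsSymbolKernel

variable {S : ℂ → E →L[ℂ] E} {D : E →L[ℂ] E} {r : ℝ → E →L[ℂ] E}

theorem axis_ae_eq (h : IsSymbolKernel S D r) : axis S =ᵐ[volume] fun ξ => D + 𝓕 r ξ := by
  filter_upwards [ae_comp_two_pi_mul h.symbol_eq] with ξ hξ
  rw [axis, hξ, Real.fourier_real_eq_integral_exp_smul]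
  congr 2
  ext1 t
  congr 2
  push_cast
  ring

theorem memLp_axis (h : IsSymbolKernel S D r) : MemLp (axis S) ⊤ (volume : Measure ℝ) := by
  refine (memLp_congr_ae h.axis_ae_eq).2 (memLp_top_of_bound ?_ (‖D‖ + ∫ t, ‖r t‖) ?_)
  · have : Continuous (𝓕 r) := VectorFourier.fourierIntegral_continuous
      Real.continuous_fourierChar (by exact continuous_inner) h.integrable
    exact (continuous_const.add this).aestronglyMeasurable
  · refine Eventually.of_forall fun ξ => (norm_add_le _ _).trans ?_
    gcongr
    exact VectorFourier.norm_fourierIntegral_le_integral_norm _ _ _ _ _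

end IsSymbolKernel

omit [CompleteSpace E] in
/-- For `r` integrable and `f` square integrable, the integral defining `(r * f)(t)` converges
for almost all `t`, since `‖r‖ ‖f‖ ≤ ‖r‖ + ‖r‖ ‖f‖²`. -/
theorem ae_integrable_convolution {r : ℝ → E →L[ℂ] E} (hr : Integrable r) (f : L2Line E) :
    ∀ᵐ t : ℝ, Integrable fun τ => ‖f τ‖ * ‖r (t - τ)‖ := by
  have hf : Integrable fun τ => ‖f τ‖ ^ 2 := (Lp.memLp f).integrable_norm_pow two_ne_zero
  filter_upwards [hf.ae_convolution_exists (ContinuousLinearMap.mul ℝ ℝ) hr.norm] with t ht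
  have ht : Integrable fun τ => ‖f τ‖ ^ 2 * ‖r (t - τ)‖ := ht
  have hrt : Integrable fun τ => ‖r (t - τ)‖ := (hr.comp_sub_left t).norm
  refine (ht.add hrt).mono' ((Lp.aestronglyMeasurable f).norm.mul hrt.1) ?_
  refine Eventually.of_forall fun τ => ?_
  have h1 := norm_nonneg (f τ)
  have h2 := norm_nonneg (r (t - τ))
  simp only [norm_mul, norm_norm, Pi.add_apply]
  nlinarith [mul_nonneg h2 (sq_nonneg (‖f τ‖ - 1))]

theorem aestronglyMeasurable_convolution {r : ℝ → E →L[ℂ] E} (hr : Integrable r) (f : L2Line E)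
    (t : ℝ) : AEStronglyMeasurable (fun τ => r (t - τ) (f τ)) volume :=
  (ContinuousLinearMap.id ℂ (E →L[ℂ] E)).aestronglyMeasurable_comp₂ (hr.comp_sub_left t).1
    (Lp.aestronglyMeasurable f)

namespace IsSymbolKernel

variable {S : ℂ → E →L[ℂ] E} {D : E →L[ℂ] E} {r : ℝ → E →L[ℂ] E}

/-- On `L¹ ∩ L²` the Laurent operator acts by convolution with the kernel, since both sides have
the same Fourier transform. -/
theorem laurent_ae_eq_of_integrable (h : IsSymbolKernel S D r) (f : L2Line E)
    (hf : Integrable f) :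
    laurent S f =ᵐ[volume] fun t => D (f t) + ∫ τ, r (t - τ) (f τ) := by
  let L : E →L[ℂ] (E →L[ℂ] E) →L[ℂ] E := (ContinuousLinearMap.id ℂ (E →L[ℂ] E)).flip
  have hc : Integrable (f ⋆[L] r) := hf.integrable_convolution L h.integrable
  have hD : Integrable fun t => D (f t) := D.integrable_comp hf
  refine ae_eq_of_fourier_ae_eq (g := (fun t => D (f t)) + (f ⋆[L] r)) (hD.add hc) ?_
  have e1 : (𝓕 (laurent S f) : L2Line E) = mulOp (axis S) (fourierL2 E f) :=
    (fourierL2 E).apply_symm_apply _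
  have e2 : (fourierL2 E f) =ᵐ[volume] 𝓕 (f : ℝ → E) := by
    have := fourier_toLp_ae_eq hf (Lp.memLp f)
    rwa [Lp.toLp_coeFn] at this
  rw [e1]
  filter_upwards [coeFn_mulOp h.memLp_axis (fourierL2 E f), e2, h.axis_ae_eq] with ξ h1 h2 h3
  have h4 : 𝓕 ((fun t => D (f t)) + (f ⋆[L] r)) = 𝓕 (fun t => D (f t)) + 𝓕 (f ⋆[L] r) :=
    VectorFourier.fourierIntegral_add (L := innerₗ ℝ) Real.continuous_fourierChar
      (by exact continuous_inner) hD hc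
  have h5 : 𝓕 (fun t => D (f t)) ξ = D (𝓕 (f : ℝ → E) ξ) := by
    rw [Real.fourier_real_eq_integral_exp_smul, Real.fourier_real_eq_integral_exp_smul,
      ← D.integral_comp_comm]
    · simp
    · refine (hf.norm).mono' ?_ ?_
      · exact (Continuous.aestronglyMeasurable (by fun_prop)).smul hf.1
      · refine Eventually.of_forall fun t => ?_
        rw [norm_smul, Complex.norm_exp_ofReal_mul_I, one_mul]
  rw [h1, h2, h3, h4, Pi.add_apply, h5, Real.fourier_bilin_convolution_eq L hf h.integrable]
  rfl

/-- The Laurent operator acts by convolution with the kernel. For general `f` this is obtained from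
the truncations of `f` to bounded intervals, with dominated convergence in the convolution
integral. -/
theorem laurent_ae_eq (h : IsSymbolKernel S D r) (f : L2Line E) :
    laurent S f =ᵐ[volume] fun t => D (f t) + ∫ τ, r (t - τ) (f τ) := by
  have hmem : ∀ n : ℕ, MemLp ((Icc (-n : ℝ) n).indicator f) 2 volume := fun n =>
    (Lp.memLp f).indicator measurableSet_Icc
  let F : ℕ → L2Line E := fun n => (hmem n).toLp _
  have hF : ∀ n, F n =ᵐ[volume] (Icc (-n : ℝ) n).indicator f := fun n => (hmem n).coeFn_toLp
  have hind : ∀ t : ℝ, ∀ᶠ n : ℕ in atTop, (Icc (-n : ℝ) n).indicator f t = f t := by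
    intro t
    obtain ⟨N, hN⟩ := exists_nat_ge |t|
    filter_upwards [eventually_ge_atTop N] with n hn
    have : |t| ≤ n := hN.trans (by exact_mod_cast hn)
    exact indicator_of_mem (mem_Icc.2 (abs_le.1 this)) f
  have hFf : Tendsto F atTop (𝓝 f) := by
    rw [Lp.tendsto_Lp_iff_tendsto_eLpNorm']
    have h0 : ∀ n, eLpNorm (⇑(F n) - ⇑f) 2 volume =
        (∫⁻ t, ‖(Icc (-n : ℝ) n).indicator f t - f t‖ₑ ^ (2 : ℝ)) ^ (1 / 2 : ℝ) := by
      intro n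
      rw [eLpNorm_congr_ae ((hF n).sub (ae_eq_refl f)),
        eLpNorm_eq_lintegral_rpow_enorm_toReal two_ne_zero ENNReal.ofNat_ne_top]
      simp
    simp_rw [h0]
    have h1 : Tendsto (fun n : ℕ => ∫⁻ t, ‖(Icc (-n : ℝ) n).indicator f t - f t‖ₑ ^ (2 : ℝ))
        atTop (𝓝 (∫⁻ _ : ℝ, 0)) := by
      refine tendsto_lintegral_of_dominated_convergence' (fun t => ‖f t‖ₑ ^ (2 : ℝ)) (fun n => ?_)
        (fun n => Eventually.of_forall fun t => ?_) ?_ (Eventually.of_forall fun t => ?_)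
      · exact ((((Lp.aestronglyMeasurable f).indicator measurableSet_Icc).sub
          (Lp.aestronglyMeasurable f)).enorm).pow_const _
      · by_cases ht : t ∈ Icc (-(n : ℝ)) n <;> simp [ht]
      · have := (Lp.memLp f).2
        rw [eLpNorm_lt_top_iff_lintegral_rpow_enorm_lt_top two_ne_zero ENNReal.ofNat_ne_top] at this
        simpa using this.ne
      · refine tendsto_const_nhds.congr' ?_
        filter_upwards [hind t] with n hn
        simp [hn]
    rw [lintegral_zero] at h1
    have h2 := ((ENNReal.continuous_rpow_const (y := 1 / 2)).tendsto 0).comp h1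
    rwa [ENNReal.zero_rpow_of_pos (by norm_num)] at h2
  have hFint : ∀ n, Integrable (F n) := by
    intro n
    refine Integrable.congr ?_ (hF n).symm
    rw [integrable_indicator_iff measurableSet_Icc]
    have := (Lp.memLp f).restrict (Icc (-n : ℝ) n)
    exact this.integrable one_le_two
  have hL : Tendsto (fun n => laurent S (F n)) atTop (𝓝 (laurent S f)) :=
    ((laurent S).continuous.tendsto f).comp hFf
  obtain ⟨ns, hns, hlim⟩ := (tendstoInMeasure_of_tendsto_Lp hL).exists_seq_tendsto_ae
  filter_upwards [hlim, ae_all_iff.2 fun n => h.laurent_ae_eq_of_integrable (F n) (hFint n),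
    ae_all_iff.2 hF, ae_integrable_convolution h.integrable f] with t h1 h2 h3 h4
  refine tendsto_nhds_unique h1 ?_
  have e1 : ∀ n, laurent S (F n) t = D ((Icc (-n : ℝ) n).indicator f t) +
      ∫ τ, r (t - τ) ((Icc (-n : ℝ) n).indicator f τ) := by
    intro n
    rw [h2, h3]
    congr 1
    refine integral_congr_ae ?_
    filter_upwards [hF n] with τ hτ
    rw [hτ]
  simp_rw [e1]
  refine Tendsto.add ?_ ?_
  · have hD : Tendsto (fun n : ℕ => D ((Icc (-n : ℝ) n).indicator f t)) atTop (𝓝 (D (f t))) := by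
      refine tendsto_const_nhds.congr' ?_
      filter_upwards [hind t] with n hn
      rw [hn]
    exact hD.comp hns.tendsto_atTop
  · refine Tendsto.comp (g := fun n : ℕ => ∫ τ, r (t - τ) ((Icc (-n : ℝ) n).indicator f τ)) ?_
      hns.tendsto_atTop
    refine tendsto_integral_of_dominated_convergence _ (fun n => ?_) h4 (fun n => ?_) ?_
    · have := (aestronglyMeasurable_convolution h.integrable f t).indicator
        (measurableSet_Icc (a := -(n : ℝ)) (b := n))
      refine this.congr (Eventually.of_forall fun τ => ?_)
      by_cases hτ : τ ∈ Icc (-(n : ℝ)) n <;> simp [hτ]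
    · refine Eventually.of_forall fun τ => ((r (t - τ)).le_opNorm _).trans ?_
      rw [mul_comm]
      gcongr
      exact norm_indicator_le_norm_self _ _
    · refine Eventually.of_forall fun τ => tendsto_const_nhds.congr' ?_
      filter_upwards [hind τ] with n hn
      rw [hn]

end IsSymbolKernel

end LaurentOperators

section HalfLine

open ContinuousLinearMap

variable {E : Type*} [NormedAddCommGroup E] [InnerProductSpace ℂ E] [CompleteSpace E]

/-! ### Compression to the half line -/

/-- The restriction `L²(ℝ; E) → L²₊(E)`. -/
def restrict (E : Type*) [NormedAddCommGroup E] [InnerProductSpace ℂ E] :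
    L2Line E →L[ℂ] L2Plus E :=
  LpToLpRestrictCLM ℝ E ℂ volume 2 (Ioi 0)

omit [CompleteSpace E] in
theorem coeFn_restrict (g : L2Line E) : restrict E g =ᵐ[halfLine] g :=
  LpToLpRestrictCLM_coeFn ℂ (Ioi 0) g

/-- The extension by zero `L²₊(E) → L²(ℝ; E)`, encoded as the adjoint of the restriction;
`coeFn_extend` identifies it. -/
def extend (E : Type*) [NormedAddCommGroup E] [InnerProductSpace ℂ E] [CompleteSpace E] :
    L2Plus E →L[ℂ] L2Line E := adjoint (restrict E)

theorem coeFn_extend (f : L2Plus E) :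
    extend E f =ᵐ[volume] (Ioi (0 : ℝ)).indicator f := by
  have hmem : MemLp ((Ioi (0 : ℝ)).indicator f) 2 volume :=
    (memLp_indicator_iff_restrict measurableSet_Ioi).2 (Lp.memLp f)
  have h : extend E f = hmem.toLp _ := by
    refine ext_inner_right ℂ fun g => ?_
    rw [extend, adjoint_inner_left, L2.inner_def, L2.inner_def,
      ← integral_indicator measurableSet_Ioi]
    refine integral_congr_ae ?_
    filter_upwards [hmem.coeFn_toLp,
      (ae_restrict_iff' measurableSet_Ioi).1 (coeFn_restrict g)] with t h1 h2
    rw [h1]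
    by_cases ht : t ∈ Ioi (0 : ℝ)
    · simp [ht, h2 ht]
    · simp [ht]
  rw [h]
  exact hmem.coeFn_toLp

theorem adjoint_restrict : adjoint (restrict E) = extend E := rfl

theorem adjoint_extend : adjoint (extend E) = restrict E := adjoint_adjoint _

theorem restrict_extend (f : L2Plus E) : restrict E (extend E f) = f := by
  refine Lp.ext ?_
  filter_upwards [coeFn_restrict (extend E f), ae_restrict_of_ae (coeFn_extend f),
    ae_restrict_mem measurableSet_Ioi] with t h1 h2 h3
  rw [h1, h2, indicator_of_mem h3]

theorem extend_restrict_ae_eq (g : L2Line E) :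
    extend E (restrict E g) =ᵐ[volume] (Ioi (0 : ℝ)).indicator g := by
  filter_upwards [coeFn_extend (restrict E g),
    (ae_restrict_iff' measurableSet_Ioi).1 (coeFn_restrict g)] with t h1 h2
  rw [h1]
  by_cases ht : t ∈ Ioi (0 : ℝ)
  · simp [ht, h2 ht]
  · simp [ht]

/-- The projections onto the functions supported on the two half lines add up to the identity. -/
theorem extend_restrict_add (g : L2Line E) :
    extend E (restrict E g) + reflect E (extend E (restrict E (reflect E g))) = g := by
  refine Lp.ext ?_
  have h0 : ∀ᵐ t : ℝ, t ≠ 0 := by simp [ae_iff]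
  filter_upwards [extend_restrict_ae_eq g,
    Lp.coeFn_add (extend E (restrict E g)) (reflect E (extend E (restrict E (reflect E g)))),
    coeFn_reflect (extend E (restrict E (reflect E g))),
    ae_neg (extend_restrict_ae_eq (reflect E g)), ae_neg (coeFn_reflect g), h0]
    with t h1 h2 h3 h4 h5 h6
  rw [h2, Pi.add_apply, h1, h3, h4]
  rcases lt_or_gt_of_ne h6 with ht | ht
  · rw [indicator_of_notMem (by simp [ht.le]), indicator_of_mem (by simpa using ht), h5, neg_neg,
      zero_add]
  · rw [indicator_of_mem (by simpa using ht), indicator_of_notMem (by simp [ht.le]), add_zero]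

/-- Compressions to the half line are multiplicative up to a product of Hankel type. -/
theorem restrict_comp_extend (L M : L2Line E →L[ℂ] L2Line E) :
    restrict E ∘L (L ∘L M) ∘L extend E =
      (restrict E ∘L L ∘L extend E) ∘L (restrict E ∘L M ∘L extend E) +
      (restrict E ∘L L ∘L reflect E ∘L extend E) ∘L
        (restrict E ∘L reflect E ∘L M ∘L extend E) := by
  ext1 f
  have h := congrArg (fun g => restrict E (L g)) (extend_restrict_add (M (extend E f)))
  simp only [map_add] at h
  exact h.symm

/-- The Wiener-Hopf operator as a compressed Laurent operator. -/
def toeplitz (S : ℂ → E →L[ℂ] E) : L2Plus E →L[ℂ] L2Plus E :=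
  restrict E ∘L laurent S ∘L extend E

/-- The Hankel operator as a compression of a Laurent operator composed with the reflection. -/
def hankelCompression (S : ℂ → E →L[ℂ] E) : L2Plus E →L[ℂ] L2Plus E :=
  restrict E ∘L laurent S ∘L reflect E ∘L extend E

theorem adjoint_toeplitz (S : ℂ → E →L[ℂ] E) :
    adjoint (toeplitz S) = restrict E ∘L adjoint (laurent S) ∘L extend E := by
  simp [toeplitz, adjoint_comp, adjoint_extend, adjoint_restrict, ContinuousLinearMap.comp_assoc]

theorem adjoint_hankelCompression (S : ℂ → E →L[ℂ] E) :
    adjoint (hankelCompression S) =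
      restrict E ∘L reflect E ∘L adjoint (laurent S) ∘L extend E := by
  simp [hankelCompression, adjoint_comp, adjoint_extend, adjoint_restrict, adjoint_reflect,
    ContinuousLinearMap.comp_assoc]

omit [CompleteSpace E] in
theorem integral_indicator_apply (r : ℝ → E →L[ℂ] E) (f : ℝ → E) :
    ∫ τ, r τ ((Ioi (0 : ℝ)).indicator f τ) = ∫ τ in Ioi (0 : ℝ), r τ (f τ) := by
  rw [← integral_indicator measurableSet_Ioi]
  congr 1
  ext1 τ
  by_cases hτ : τ ∈ Ioi (0 : ℝ) <;> simp [hτ]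

namespace IsSymbolKernel

variable {S : ℂ → E →L[ℂ] E} {D : E →L[ℂ] E} {r : ℝ → E →L[ℂ] E}

theorem laurent_extend_ae_eq (h : IsSymbolKernel S D r) (f : L2Plus E) :
    laurent S (extend E f) =ᵐ[volume] fun t =>
      D ((Ioi (0 : ℝ)).indicator f t) + ∫ τ in Ioi (0 : ℝ), r (t - τ) (f τ) := by
  filter_upwards [h.laurent_ae_eq (extend E f), coeFn_extend f] with t h1 h2
  rw [h1, h2, ← integral_indicator_apply]
  congr 1
  refine integral_congr_ae ?_
  filter_upwards [coeFn_extend f] with τ hτ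
  rw [hτ]

theorem toeplitz_ae_eq (h : IsSymbolKernel S D r) (f : L2Plus E) :
    toeplitz S f =ᵐ[halfLine] fun t => D (f t) + ∫ τ in Ioi (0 : ℝ), r (t - τ) (f τ) := by
  filter_upwards [coeFn_restrict (laurent S (extend E f)),
    ae_restrict_of_ae (h.laurent_extend_ae_eq f), ae_restrict_mem measurableSet_Ioi]
    with t h1 h2 h3
  rw [indicator_of_mem h3] at h2
  exact h1.trans h2

theorem hankelCompression_ae_eq (h : IsSymbolKernel S D r) (f : L2Plus E) :
    hankelCompression S f =ᵐ[halfLine] fun t => ∫ τ in Ioi (0 : ℝ), r (t + τ) (f τ) := by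
  have hJ : reflect E (extend E f) =ᵐ[volume] fun t => (Ioi (0 : ℝ)).indicator f (-t) := by
    filter_upwards [coeFn_reflect (extend E f), ae_neg (coeFn_extend f)] with t h1 h2
    rw [h1, h2]
  filter_upwards [coeFn_restrict (laurent S (reflect E (extend E f))),
    ae_restrict_of_ae (h.laurent_ae_eq (reflect E (extend E f))),
    ae_restrict_of_ae hJ, ae_restrict_mem measurableSet_Ioi] with t h1 h2 h3 h4
  refine h1.trans (h2.trans ?_)
  have h5 : -t ∉ Ioi (0 : ℝ) := by simpa using (mem_Ioi.1 h4).le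
  rw [h3, indicator_of_notMem h5, map_zero, zero_add,
    ← integral_indicator_apply (fun τ => r (t + τ)), ← integral_neg_eq_self]
  refine integral_congr_ae ?_
  filter_upwards [ae_neg hJ] with τ hτ
  rw [hτ, neg_neg, sub_neg_eq_add]

theorem isWienerHopfOperator (h : IsSymbolKernel S D r) :
    IsWienerHopfOperator S (toeplitz S) :=
  ⟨D, r, h, h.toeplitz_ae_eq⟩

theorem isHankelOperator (h : IsSymbolKernel S D r) (hr : ∀ t < 0, r t = 0) :
    IsHankelOperator S (hankelCompression S) :=
  ⟨D, r, h, hr, h.hankelCompression_ae_eq⟩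

/-- A Laurent operator with kernel on the positive half line preserves functions supported there. -/
theorem extend_restrict_laurent (h : IsSymbolKernel S D r) (hr : ∀ t < 0, r t = 0)
    (f : L2Plus E) :
    extend E (restrict E (laurent S (extend E f))) = laurent S (extend E f) := by
  refine Lp.ext ?_
  have h0 : ∀ᵐ t : ℝ, t ≠ 0 := by simp [ae_iff]
  filter_upwards [extend_restrict_ae_eq (laurent S (extend E f)), h.laurent_extend_ae_eq f, h0]
    with t h1 h2 h3
  rw [h1]
  rcases lt_or_gt_of_ne h3 with ht | ht
  · rw [indicator_of_notMem (by simp [ht.le]), h2, indicator_of_notMem (by simp [ht.le]),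
      map_zero, zero_add]
    refine (integral_eq_zero_of_ae ?_).symm
    filter_upwards [ae_restrict_mem measurableSet_Ioi] with τ hτ
    rw [hr (t - τ) (by linarith [mem_Ioi.1 hτ])]
    rfl
  · rw [indicator_of_mem (by simpa using ht)]

end IsSymbolKernel

/-- Any Wiener-Hopf operator with symbol `S` is the compression of the Laurent operator, which
depends on `S` alone; hence it does not depend on the choice of the kernel. -/
theorem IsWienerHopfOperator.eq_toeplitz {S : ℂ → E →L[ℂ] E} {T : L2Plus E →L[ℂ] L2Plus E}
    (h : IsWienerHopfOperator S T) : T = toeplitz S := by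
  obtain ⟨D, r, hS, hT⟩ := h
  ext1 f
  refine Lp.ext ?_
  filter_upwards [hT f, hS.toeplitz_ae_eq f] with t h1 h2
  rw [h1, h2]

theorem IsHankelOperator.eq_hankelCompression {S : ℂ → E →L[ℂ] E}
    {H : L2Plus E →L[ℂ] L2Plus E} (h : IsHankelOperator S H) : H = hankelCompression S := by
  obtain ⟨D, r, hS, -, hH⟩ := h
  ext1 f
  refine Lp.ext ?_
  filter_upwards [hH f, hS.hankelCompression_ae_eq f] with t h1 h2
  rw [h1, h2]

theorem IsSymbolKernel.existsUnique_wienerHopf {S : ℂ → E →L[ℂ] E} {D : E →L[ℂ] E}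
    {r : ℝ → E →L[ℂ] E} (h : IsSymbolKernel S D r) : ∃! T, IsWienerHopfOperator S T :=
  ⟨toeplitz S, h.isWienerHopfOperator, fun _ hT => hT.eq_toeplitz⟩

theorem IsSymbolKernel.existsUnique_hankel {S : ℂ → E →L[ℂ] E} {D : E →L[ℂ] E}
    {r : ℝ → E →L[ℂ] E} (h : IsSymbolKernel S D r) (hr : ∀ t < 0, r t = 0) :
    ∃! H, IsHankelOperator S H :=
  ⟨hankelCompression S, h.isHankelOperator hr, fun _ hH => hH.eq_hankelCompression⟩

theorem IsSymbolKernel.wienerHopf_eq {S : ℂ → E →L[ℂ] E} {D : E →L[ℂ] E}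
    {r : ℝ → E →L[ℂ] E} (h : IsSymbolKernel S D r) : wienerHopf S = toeplitz S :=
  IsWienerHopfOperator.eq_toeplitz (Classical.epsilon_spec ⟨_, h.isWienerHopfOperator⟩)

theorem IsSymbolKernel.hankel_eq {S : ℂ → E →L[ℂ] E} {D : E →L[ℂ] E}
    {r : ℝ → E →L[ℂ] E} (h : IsSymbolKernel S D r) (hr : ∀ t < 0, r t = 0) :
    hankel S = hankelCompression S :=
  IsHankelOperator.eq_hankelCompression (Classical.epsilon_spec ⟨_, h.isHankelOperator hr⟩)

/-! ### Operator identities from symbol identities -/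

theorem axis_symbolVW (V W : ℂ → E →L[ℂ] E) :
    axis (symbolVW V W) = fun ξ => axis V ξ ∘L adjoint (axis W ξ) := by
  ext1 ξ
  have h : -conj (((2 * Real.pi * ξ : ℝ) : ℂ) * Complex.I) =
      ((2 * Real.pi * ξ : ℝ) : ℂ) * Complex.I := by
    rw [map_mul, Complex.conj_ofReal, Complex.conj_I, mul_neg, neg_neg]
  rw [axis, symbolVW, para, h]
  rfl

theorem axis_tilde (V : ℂ → E →L[ℂ] E) : axis (tilde V) = fun ξ => adjoint (axis V (-ξ)) := by
  ext1 ξ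
  have h : conj (((2 * Real.pi * ξ : ℝ) : ℂ) * Complex.I) =
      ((2 * Real.pi * (-ξ) : ℝ) : ℂ) * Complex.I := by
    rw [map_mul, Complex.conj_ofReal, Complex.conj_I, mul_neg, mul_neg, Complex.ofReal_neg,
      neg_mul]
  rw [axis, tilde, h]
  rfl

theorem adjoint_laurent_apply {V : ℂ → E →L[ℂ] E} (hV : MemLp (axis V) ⊤ (volume : Measure ℝ))
    (f : L2Line E) : adjoint (laurent V) f =
      (fourierL2 E).symm (mulOp (fun ξ => adjoint (axis V ξ)) (fourierL2 E f)) := by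
  rw [laurent, adjoint_comp, adjoint_comp, adjoint_mulOp hV,
    LinearIsometryEquiv.adjoint_eq_symm, LinearIsometryEquiv.adjoint_eq_symm]
  rfl

theorem laurent_symbolVW {V W : ℂ → E →L[ℂ] E} (hV : MemLp (axis V) ⊤ (volume : Measure ℝ))
    (hW : MemLp (axis W) ⊤ (volume : Measure ℝ)) :
    laurent (symbolVW V W) = laurent V ∘L adjoint (laurent W) := by
  ext1 f
  rw [comp_apply, adjoint_laurent_apply hW, laurent_apply, laurent_apply, axis_symbolVW,
    ← mulOp_comp hV (memLp_top_adjoint hW), LinearIsometryEquiv.apply_symm_apply]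
  rfl

theorem laurent_tilde {V : ℂ → E →L[ℂ] E} (hV : MemLp (axis V) ⊤ (volume : Measure ℝ)) :
    laurent (tilde V) = reflect E ∘L adjoint (laurent V) ∘L reflect E := by
  have hJ : ∀ g, reflect E ((fourierL2 E).symm g) = (fourierL2 E).symm (reflect E g) := fun g => by
    rw [← fourier_reflect, reflect_fourier]
  ext1 f
  rw [comp_apply, comp_apply, adjoint_laurent_apply hV, laurent_apply, axis_tilde,
    ← mulOp_reflect (memLp_top_adjoint hV), hJ, fourier_reflect, reflect_fourier]

theorem laurent_comp_adjoint_self {V : ℂ → E →L[ℂ] E}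
    (hVm : MemLp (axis V) ⊤ (volume : Measure ℝ))
    (hV : ∀ᵐ ω : ℝ, V (ω * Complex.I) ∈ unitary (E →L[ℂ] E)) :
    laurent V ∘L adjoint (laurent V) = ContinuousLinearMap.id ℂ _ := by
  have h : axis (symbolVW V V) =ᵐ[volume] fun _ => ContinuousLinearMap.id ℂ E := by
    filter_upwards [ae_comp_two_pi_mul hV] with ξ hξ
    rw [axis_symbolVW]
    exact (Unitary.mem_iff.1 hξ).2
  ext1 f
  rw [← laurent_symbolVW hVm hVm, laurent_apply,
    mulOp_congr ((memLp_congr_ae h).2 (memLp_top_const _)) h, mulOp_one]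
  exact (fourierL2 E).symm_apply_apply f

theorem adjoint_laurent_comp_self {V : ℂ → E →L[ℂ] E}
    (hVm : MemLp (axis V) ⊤ (volume : Measure ℝ))
    (hV : ∀ᵐ ω : ℝ, V (ω * Complex.I) ∈ unitary (E →L[ℂ] E)) :
    adjoint (laurent V) ∘L laurent V = ContinuousLinearMap.id ℂ _ := by
  have h : (fun ξ => adjoint (axis V ξ) ∘L axis V ξ) =ᵐ[volume]
      fun _ => ContinuousLinearMap.id ℂ E := by
    filter_upwards [ae_comp_two_pi_mul hV] with ξ hξ
    exact (Unitary.mem_iff.1 hξ).1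
  ext1 f
  rw [comp_apply, adjoint_laurent_apply hVm, laurent_apply, LinearIsometryEquiv.apply_symm_apply,
    ← comp_apply (mulOp _) (mulOp _), mulOp_comp (memLp_top_adjoint hVm) hVm,
    mulOp_congr ((memLp_congr_ae h).2 (memLp_top_const _)) h, mulOp_one]
  exact (fourierL2 E).symm_apply_apply f

/-- `T_{VW*} = T_V T_W* + H_V H_W*`. -/
theorem toeplitz_symbolVW {V W : ℂ → E →L[ℂ] E} (hV : MemLp (axis V) ⊤ (volume : Measure ℝ))
    (hW : MemLp (axis W) ⊤ (volume : Measure ℝ)) :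
    toeplitz (symbolVW V W) = toeplitz V ∘L adjoint (toeplitz W) +
      hankelCompression V ∘L adjoint (hankelCompression W) := by
  rw [adjoint_toeplitz, adjoint_hankelCompression, toeplitz, laurent_symbolVW hV hW,
    restrict_comp_extend]
  rfl

/-- `T_V T_V* + H_V H_V* = 1` for unitary symbols. -/
theorem toeplitz_add_hankel {V : ℂ → E →L[ℂ] E} (hVm : MemLp (axis V) ⊤ (volume : Measure ℝ))
    (hV : ∀ᵐ ω : ℝ, V (ω * Complex.I) ∈ unitary (E →L[ℂ] E)) :
    toeplitz V ∘L adjoint (toeplitz V) +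
      hankelCompression V ∘L adjoint (hankelCompression V) = ContinuousLinearMap.id ℂ _ := by
  rw [← toeplitz_symbolVW hVm hVm, toeplitz, laurent_symbolVW hVm hVm,
    laurent_comp_adjoint_self hVm hV]
  exact ContinuousLinearMap.ext restrict_extend

/-- `H_V* H_V + T_Ṽ T_Ṽ* = 1` for unitary symbols. -/
theorem hankel_add_toeplitz_tilde {V : ℂ → E →L[ℂ] E}
    (hVm : MemLp (axis V) ⊤ (volume : Measure ℝ))
    (hV : ∀ᵐ ω : ℝ, V (ω * Complex.I) ∈ unitary (E →L[ℂ] E)) :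
    adjoint (hankelCompression V) ∘L hankelCompression V +
      toeplitz (tilde V) ∘L adjoint (toeplitz (tilde V)) = ContinuousLinearMap.id ℂ _ := by
  have hJJ : reflect E ∘L reflect E = ContinuousLinearMap.id ℂ (L2Line E) :=
    ContinuousLinearMap.ext reflect_reflect
  have h := restrict_comp_extend (reflect E ∘L adjoint (laurent V)) (laurent V ∘L reflect E)
  have h1 : (reflect E ∘L adjoint (laurent V)) ∘L (laurent V ∘L reflect E) =
      ContinuousLinearMap.id ℂ _ := by
    change reflect E ∘L (adjoint (laurent V) ∘L laurent V) ∘L reflect E = _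
    rw [adjoint_laurent_comp_self hVm hV, ContinuousLinearMap.id_comp, hJJ]
  have h2 : adjoint (toeplitz (tilde V)) =
      restrict E ∘L reflect E ∘L laurent V ∘L reflect E ∘L extend E := by
    rw [adjoint_toeplitz, laurent_tilde hVm, adjoint_comp, adjoint_comp, adjoint_adjoint,
      adjoint_reflect]
    rfl
  rw [h1] at h
  rw [adjoint_hankelCompression, h2, toeplitz, laurent_tilde hVm]
  exact h.symm.trans (ContinuousLinearMap.ext restrict_extend)

/-- For a unitary symbol with a kernel on the positive half line, the Wiener-Hopf operator is an
isometry. -/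
theorem IsSymbolKernel.adjoint_toeplitz_comp {V : ℂ → E →L[ℂ] E} {D : E →L[ℂ] E}
    {r : ℝ → E →L[ℂ] E} (h : IsSymbolKernel V D r) (hr : ∀ t < 0, r t = 0)
    (hV : ∀ᵐ ω : ℝ, V (ω * Complex.I) ∈ unitary (E →L[ℂ] E)) :
    adjoint (toeplitz V) ∘L toeplitz V = ContinuousLinearMap.id ℂ _ := by
  ext1 f
  rw [adjoint_toeplitz]
  change restrict E (adjoint (laurent V) (extend E (restrict E (laurent V (extend E f))))) = f
  rw [h.extend_restrict_laurent hr, ← comp_apply (adjoint (laurent V)),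
    adjoint_laurent_comp_self h.memLp_axis hV]
  exact restrict_extend f

end HalfLine

section WienerAlgebra

open FourierTransform ContinuousLinearMap
open scoped Convolution

/-! ### The Wiener algebra -/

section FourierLaplace

variable {F G : Type*} [NormedAddCommGroup F] [NormedSpace ℂ F] [NormedAddCommGroup G]
  [NormedSpace ℂ G]

theorem integral_exp_smul_eq_fourier (r : ℝ → F) (ω : ℝ) :
    ∫ t : ℝ, Complex.exp (-(ω * Complex.I) * t) • r t = 𝓕 r (ω / (2 * Real.pi)) := by
  rw [Real.fourier_real_eq_integral_exp_smul]
  congr 1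
  ext1 t
  congr 2
  push_cast
  field_simp

theorem integrable_exp_smul {r : ℝ → F} (hr : Integrable r) (ω : ℝ) :
    Integrable fun t : ℝ => Complex.exp (-(ω * Complex.I) * t) • r t := by
  refine hr.norm.mono' ((Continuous.aestronglyMeasurable (by fun_prop)).smul hr.1) ?_
  refine Eventually.of_forall fun t => ?_
  have : -((ω : ℂ) * Complex.I) * t = ((-(ω * t) : ℝ) : ℂ) * Complex.I := by
    push_cast; ring
  rw [norm_smul, this, Complex.norm_exp_ofReal_mul_I, one_mul]

theorem integral_exp_smul_clm_comp [CompleteSpace F] [CompleteSpace G] (L : F →L[ℂ] G) {r : ℝ → F}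
    (hr : Integrable r) (ω : ℝ) :
    ∫ t : ℝ, Complex.exp (-(ω * Complex.I) * t) • L (r t) =
      L (∫ t : ℝ, Complex.exp (-(ω * Complex.I) * t) • r t) := by
  rw [← L.integral_comp_comm (integrable_exp_smul hr ω)]
  simp

end FourierLaplace

variable {E : Type*} [NormedAddCommGroup E] [InnerProductSpace ℂ E]

theorem integral_exp_smul_adjoint [CompleteSpace E] (r : ℝ → E →L[ℂ] E) (ω : ℝ) :
    ∫ t : ℝ, Complex.exp (-(ω * Complex.I) * t) • adjoint (r t) =
      adjoint (∫ t : ℝ, Complex.exp (-((-ω : ℝ) * Complex.I) * t) • r t) := by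
  rw [← star_eq_adjoint]
  change _ = starL' ℝ (∫ t : ℝ, Complex.exp (-((-ω : ℝ) * Complex.I) * t) • r t)
  rw [← ContinuousLinearEquiv.integral_comp_comm]
  congr 1
  ext1 t
  change _ = star (Complex.exp (-((-ω : ℝ) * Complex.I) * t) • r t)
  rw [star_smul, star_eq_adjoint]
  congr 1
  rw [Complex.star_def, ← Complex.exp_conj]
  simp

namespace IsSymbolKernel

variable {S S' : ℂ → E →L[ℂ] E} {D D' : E →L[ℂ] E} {r r' : ℝ → E →L[ℂ] E}

/-- The values of a symbol on a finite set are irrelevant. -/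
theorem congr_of_finite (h : IsSymbolKernel S D r) {s : Set ℂ} (hs : s.Finite)
    (hS : ∀ z ∉ s, S' z = S z) : IsSymbolKernel S' D r where
  tendsto_infty := by
    refine h.tendsto_infty.congr' ?_
    have h0 : sᶜ ∈ Bornology.cobounded ℂ := Bornology.isBounded_def.1 hs.isBounded
    filter_upwards [h0] with z hz
    exact (hS z hz).symm
  integrable := h.integrable
  symbol_eq := by
    have h1 : ((fun ω : ℝ => (ω : ℂ) * Complex.I) ⁻¹' s).Finite :=
      hs.preimage (fun x _ y _ hxy => by simpa using hxy)
    filter_upwards [h.symbol_eq, h1.countable.ae_notMem volume] with ω h2 h3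
    rw [hS _ h3, h2]

theorem const (A : E →L[ℂ] E) : IsSymbolKernel (fun _ => A) A 0 := by
  refine ⟨tendsto_const_nhds, integrable_zero ℝ (E →L[ℂ] E) _, Eventually.of_forall fun ω => ?_⟩
  simp only [Pi.zero_apply, smul_zero, integral_zero, add_zero]

theorem add (h : IsSymbolKernel S D r) (h' : IsSymbolKernel S' D' r') :
    IsSymbolKernel (fun s => S s + S' s) (D + D') (r + r') := by
  refine ⟨h.tendsto_infty.add h'.tendsto_infty,
    Integrable.add (ε' := E →L[ℂ] E) h.integrable h'.integrable, ?_⟩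
  filter_upwards [h.symbol_eq, h'.symbol_eq] with ω h1 h2
  simp only [Pi.add_apply, smul_add]
  rw [integral_add (integrable_exp_smul h.integrable ω) (integrable_exp_smul h'.integrable ω),
    h1, h2]
  abel

variable [CompleteSpace E]

/-- The product of two symbols has the kernel `D r' + r D' + r * r'`. -/
theorem comp (h : IsSymbolKernel S D r) (h' : IsSymbolKernel S' D' r') :
    IsSymbolKernel (fun s => S s ∘L S' s) (D ∘L D')
      ((fun t => D ∘L r' t) + (fun t => r t ∘L D') + (r ⋆[compL ℂ E E E] r')) := by
  have i1 : Integrable fun t => D ∘L r' t := (compL ℂ E E E D).integrable_comp h'.integrable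
  have i2 : Integrable fun t => r t ∘L D' :=
    ((compL ℂ E E E).flip D').integrable_comp h.integrable
  have i3 : Integrable (r ⋆[compL ℂ E E E] r') :=
    h.integrable.integrable_convolution _ h'.integrable
  refine ⟨?_, (i1.add i2).add i3, ?_⟩
  · exact (((isBoundedBilinearMap_comp (𝕜 := ℂ)).continuous.tendsto (D, D')).comp
      (h.tendsto_infty.prodMk_nhds h'.tendsto_infty))
  · filter_upwards [h.symbol_eq, h'.symbol_eq] with ω h1 h2
    simp only [Pi.add_apply, smul_add]
    have e1 := integral_exp_smul_clm_comp (compL ℂ E E E D) h'.integrable ω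
    have e2 := integral_exp_smul_clm_comp ((compL ℂ E E E).flip D') h.integrable ω
    have e3 : ∫ t : ℝ, Complex.exp (-(ω * Complex.I) * t) • (r ⋆[compL ℂ E E E] r') t =
        (∫ t : ℝ, Complex.exp (-(ω * Complex.I) * t) • r t) ∘L
          (∫ t : ℝ, Complex.exp (-(ω * Complex.I) * t) • r' t) := by
      rw [integral_exp_smul_eq_fourier, integral_exp_smul_eq_fourier,
        integral_exp_smul_eq_fourier,
        Real.fourier_bilin_convolution_eq _ h.integrable h'.integrable]
      rfl
    simp only [flip_apply, compL_apply] at e1 e2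
    have i12 : Integrable fun t : ℝ => Complex.exp (-(ω * Complex.I) * t) • D ∘L r' t +
        Complex.exp (-(ω * Complex.I) * t) • r t ∘L D' :=
      (integrable_exp_smul i1 ω).add (integrable_exp_smul i2 ω)
    rw [integral_add i12 (integrable_exp_smul i3 ω), integral_add (integrable_exp_smul i1 ω)
      (integrable_exp_smul i2 ω), e1, e2, e3, h1, h2]
    simp only [add_comp, comp_add]
    abel

theorem tilde (h : IsSymbolKernel S D r) :
    IsSymbolKernel (WienerHopf.tilde S) (adjoint D) (fun t => adjoint (r t)) where
  tendsto_infty := ((adjoint (𝕜 := ℂ) (E := E) (F := E)).continuous.tendsto D).comp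
    (h.tendsto_infty.comp Complex.isometry_conj.antilipschitz.tendsto_cobounded)
  integrable := h.integrable.mono
    ((adjoint (𝕜 := ℂ) (E := E) (F := E)).continuous.comp_aestronglyMeasurable h.integrable.1)
    (Eventually.of_forall fun _ => (LinearIsometryEquiv.norm_map _ _).le)
  symbol_eq := by
    filter_upwards [ae_neg h.symbol_eq] with ω hω
    have h1 : conj ((ω : ℂ) * Complex.I) = ((-ω : ℝ) : ℂ) * Complex.I := by
      rw [map_mul, Complex.conj_ofReal, Complex.conj_I, Complex.ofReal_neg, mul_neg, neg_mul]
    rw [WienerHopf.tilde, h1, hω, map_add, integral_exp_smul_adjoint]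

omit [CompleteSpace E] in
theorem reflect (h : IsSymbolKernel S D r) :
    IsSymbolKernel (fun s => S (-s)) D (fun t => r (-t)) where
  tendsto_infty := h.tendsto_infty.comp tendsto_neg_cobounded
  integrable := h.integrable.comp_neg
  symbol_eq := by
    filter_upwards [ae_neg h.symbol_eq] with ω hω
    have h1 : -((ω : ℂ) * Complex.I) = ((-ω : ℝ) : ℂ) * Complex.I := by
      rw [Complex.ofReal_neg, neg_mul]
    rw [h1, hω, ← integral_neg_eq_self]
    simp

theorem symbolVW {V W : ℂ → E →L[ℂ] E} {D D' : E →L[ℂ] E} {v w : ℝ → E →L[ℂ] E}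
    (hV : IsSymbolKernel V D v) (hW : IsSymbolKernel W D' w) :
    ∃ D'' r, IsSymbolKernel (WienerHopf.symbolVW V W) D'' r := by
  refine ⟨_, _, (hV.comp hW.tilde.reflect).congr_of_finite finite_empty fun s _ => ?_⟩
  simp [WienerHopf.symbolVW, para, WienerHopf.tilde]

end IsSymbolKernel

/-- `S` is a constant plus the Laplace transform of an integrable function on the half line. -/
def HasCausalKernel (S : ℂ → E →L[ℂ] E) : Prop :=
  ∃ (D : E →L[ℂ] E) (θ : ℝ → E →L[ℂ] E), IsSymbolKernel S D θ ∧ ∀ t < 0, θ t = 0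

namespace HasCausalKernel

variable {S S' : ℂ → E →L[ℂ] E}

theorem congr_of_finite (h : HasCausalKernel S) {s : Set ℂ} (hs : s.Finite)
    (hS : ∀ z ∉ s, S' z = S z) : HasCausalKernel S' := by
  obtain ⟨D, θ, h1, h2⟩ := h
  exact ⟨D, θ, h1.congr_of_finite hs hS, h2⟩

theorem const (A : E →L[ℂ] E) : HasCausalKernel fun _ => A :=
  ⟨A, 0, .const A, fun _ _ => rfl⟩

theorem add (h : HasCausalKernel S) (h' : HasCausalKernel S') :
    HasCausalKernel fun s => S s + S' s := by
  obtain ⟨D, θ, h1, h2⟩ := h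
  obtain ⟨D', θ', h1', h2'⟩ := h'
  exact ⟨_, _, h1.add h1', fun t ht => by simp [h2 t ht, h2' t ht]⟩

/-- `(s - a)⁻¹` is the Laplace transform of `exp(a t)` on the half line. -/
theorem inv_sub_smul_id [CompleteSpace E] {a : ℂ} (ha : a.re < 0) :
    HasCausalKernel fun s => (s - a)⁻¹ • ContinuousLinearMap.id ℂ E := by
  have hint : IntegrableOn (fun t : ℝ => Complex.exp (a * t) • ContinuousLinearMap.id ℂ E)
      (Ioi 0) := (integrableOn_exp_mul_complex_Ioi ha 0).smul_const _
  refine ⟨0, (Ioi (0 : ℝ)).indicator fun t : ℝ =>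
    Complex.exp (a * t) • ContinuousLinearMap.id ℂ E, ⟨?_, ?_, ?_⟩, fun t ht => ?_⟩
  · have h1 : Tendsto (fun s : ℂ => (s - a)⁻¹) (Bornology.cobounded ℂ) (𝓝 0) :=
      tendsto_inv₀_cobounded.comp
        (IsometryEquiv.subRight a).isometry.antilipschitz.tendsto_cobounded
    simpa using h1.smul_const (ContinuousLinearMap.id ℂ E)
  · exact (integrable_indicator_iff measurableSet_Ioi).2 hint
  · refine Eventually.of_forall fun ω => ?_
    have hb : (a - ω * Complex.I).re < 0 := by simpa using ha
    have h0 : (fun t : ℝ => Complex.exp (-(ω * Complex.I) * t) •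
        (Ioi (0 : ℝ)).indicator (fun t : ℝ => Complex.exp (a * t) •
          ContinuousLinearMap.id ℂ E) t) = (Ioi (0 : ℝ)).indicator fun t : ℝ =>
          Complex.exp ((a - ω * Complex.I) * t) • ContinuousLinearMap.id ℂ E := by
      ext1 t
      by_cases ht : t ∈ Ioi (0 : ℝ)
      · rw [indicator_of_mem ht, indicator_of_mem ht, smul_smul, ← Complex.exp_add]
        congr 2
        ring
      · rw [indicator_of_notMem ht, indicator_of_notMem ht, smul_zero]
    rw [h0, integral_indicator measurableSet_Ioi, integral_smul_const,
      integral_exp_mul_complex_Ioi hb, zero_add]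
    congr 1
    rw [Complex.ofReal_zero, mul_zero, Complex.exp_zero, neg_div, ← one_div, ← div_neg, neg_sub]
  · exact indicator_of_notMem (by simpa using ht.le) _

variable [CompleteSpace E]

theorem comp (h : HasCausalKernel S) (h' : HasCausalKernel S') :
    HasCausalKernel fun s => S s ∘L S' s := by
  obtain ⟨D, θ, h1, h2⟩ := h
  obtain ⟨D', θ', h1', h2'⟩ := h'
  refine ⟨_, _, h1.comp h1', fun t ht => ?_⟩
  have h3 : (θ ⋆[compL ℂ E E E] θ') t = 0 := by
    rw [convolution_def]
    refine integral_eq_zero_of_ae (Eventually.of_forall fun τ => ?_)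
    rcases lt_or_ge τ 0 with hτ | hτ
    · simp [h2 τ hτ]
    · simp [h2' (t - τ) (by linarith)]
  simp [h2 t ht, h2' t ht, h3]

theorem inv_sub_smul (h : HasCausalKernel S) {a : ℂ} (ha : a.re < 0) :
    HasCausalKernel fun s => (s - a)⁻¹ • S s := by
  have := (inv_sub_smul_id (E := E) ha).comp h
  simpa using this

theorem tilde (h : HasCausalKernel S) : HasCausalKernel (WienerHopf.tilde S) := by
  obtain ⟨D, θ, h1, h2⟩ := h
  exact ⟨_, _, h1.tilde, fun t ht => by rw [h2 t ht, map_zero]⟩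

end HasCausalKernel

end WienerAlgebra

section Rational

open Polynomial

/-! ### Rational functions bounded in the right half plane -/

variable {E : Type*} [NormedAddCommGroup E] [InnerProductSpace ℂ E]

/-- The value at the scalar `s` of a polynomial with operator coefficients. -/
def opEval (P : Polynomial (E →L[ℂ] E)) (s : ℂ) : E →L[ℂ] E :=
  P.eval (algebraMap ℂ (E →L[ℂ] E) s)

theorem continuous_opEval (P : Polynomial (E →L[ℂ] E)) : Continuous (opEval P) :=
  P.continuous.comp (continuous_algebraMap ℂ _)

theorem opEval_C (A : E →L[ℂ] E) (s : ℂ) : opEval (C A) s = A := eval_C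

theorem opEval_C_mul (A : E →L[ℂ] E) (P : Polynomial (E →L[ℂ] E)) (s : ℂ) :
    opEval (C A * P) s = A ∘L opEval P s := eval_C_mul

theorem opEval_mul_X (P : Polynomial (E →L[ℂ] E)) (s : ℂ) :
    opEval (P * X) s = s • opEval P s := by
  rw [opEval, eval_mul_X, ← Algebra.commutes, ← Algebra.smul_def]
  rfl

theorem opEval_add (P Q : Polynomial (E →L[ℂ] E)) (s : ℂ) :
    opEval (P + Q) s = opEval P s + opEval Q s := eval_add

/-- Division by `X - a`. -/
theorem exists_opEval_eq_add_sub_smul (P : Polynomial (E →L[ℂ] E)) (a : ℂ) :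
    ∃ P₁ : Polynomial (E →L[ℂ] E), ∀ s, opEval P s = opEval P a + (s - a) • opEval P₁ s := by
  suffices h : ∃ (A : E →L[ℂ] E) (P₁ : Polynomial (E →L[ℂ] E)),
      ∀ s, opEval P s = A + (s - a) • opEval P₁ s by
    obtain ⟨A, P₁, h⟩ := h
    have hA : opEval P a = A := by simpa using h a
    exact ⟨P₁, by rwa [hA]⟩
  induction P using Polynomial.induction_on with
  | C A => exact ⟨A, 0, fun s => by simp [opEval]⟩
  | add P Q hP hQ =>
    obtain ⟨A, P₁, hP⟩ := hP
    obtain ⟨B, Q₁, hQ⟩ := hQ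
    refine ⟨A + B, P₁ + Q₁, fun s => ?_⟩
    rw [opEval_add, opEval_add, hP, hQ, smul_add]
    abel
  | monomial n A hP =>
    obtain ⟨B, P₁, hP⟩ := hP
    refine ⟨a • B, C B + P₁ * X, fun s => ?_⟩
    rw [pow_succ, ← mul_assoc, opEval_mul_X, hP, opEval_add, opEval_C, opEval_mul_X]
    module

/-- An inequality between continuous functions on the open right half plane with finitely many
points removed extends to the closed right half plane. -/
theorem le_of_le_off_finite {f g : ℂ → ℝ} (hf : Continuous f) (hg : Continuous g) {F : Set ℂ}
    (hF : F.Finite) (h : ∀ s : ℂ, 0 < s.re → s ∉ F → f s ≤ g s) {s : ℂ} (hs : 0 ≤ s.re) :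
    f s ≤ g s := by
  have hopen : IsOpen {s : ℂ | 0 < s.re} := isOpen_lt continuous_const Complex.continuous_re
  have h1 : Dense Fᶜ := hF.countable.dense_compl ℝ
  have h2 : closure ({s : ℂ | 0 < s.re} ∩ Fᶜ) ⊆ {s | f s ≤ g s} :=
    closure_minimal (fun z hz => h z hz.1 hz.2) (isClosed_le hf hg)
  have h3 := closure_mono (h1.open_subset_closure_inter hopen)
  rw [closure_closure, Complex.closure_setOfPred_lt_re] at h3
  exact h2 (h3 hs)

/-- `∏ (s - a)` over the roots `a` in `m`. -/
def rootProd (m : Multiset ℂ) (s : ℂ) : ℂ := (m.map fun a => s - a).prod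

theorem rootProd_zero (s : ℂ) : rootProd 0 s = 1 := by simp [rootProd]

theorem rootProd_cons (a : ℂ) (m : Multiset ℂ) (s : ℂ) :
    rootProd (a ::ₘ m) s = (s - a) * rootProd m s := by simp [rootProd]

theorem continuous_rootProd (m : Multiset ℂ) : Continuous (rootProd m) := by
  induction m using Multiset.induction_on with
  | empty => simpa [funext rootProd_zero] using continuous_const
  | cons a m ih =>
    rw [funext (rootProd_cons a m)]
    exact (continuous_id.sub continuous_const).mul ih

theorem neg_re_le_norm_sub {a s : ℂ} (hs : 0 ≤ s.re) : -a.re ≤ ‖s - a‖ := by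
  have := (s - a).re_le_norm
  rw [Complex.sub_re] at this
  linarith

theorem exists_le_norm_rootProd {m : Multiset ℂ} (hm : ∀ a ∈ m, a.re < 0) :
    ∃ δ > 0, ∀ s : ℂ, 0 ≤ s.re → δ ≤ ‖rootProd m s‖ := by
  induction m using Multiset.induction_on with
  | empty => exact ⟨1, one_pos, fun s _ => by simp [rootProd_zero]⟩
  | cons a m ih =>
    obtain ⟨δ, hδ, h⟩ := ih fun b hb => hm b (Multiset.mem_cons_of_mem hb)
    have ha : 0 < -a.re := neg_pos.2 (hm a (Multiset.mem_cons_self a m))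
    refine ⟨-a.re * δ, by positivity, fun s hs => ?_⟩
    rw [rootProd_cons, norm_mul]
    exact mul_le_mul (neg_re_le_norm_sub hs) (h s hs) hδ.le (norm_nonneg _)

/-- A polynomial that is bounded on a half line is constant. -/
theorem opEval_const_of_bounded (P : Polynomial (E →L[ℂ] E)) {M : ℝ}
    (hP : ∀ x : ℝ, 1 ≤ x → ‖opEval P x‖ ≤ M) : ∃ A : E →L[ℂ] E, ∀ s, opEval P s = A := by
  suffices h : ∀ n (P : Polynomial (E →L[ℂ] E)) (M : ℝ), P.natDegree ≤ n →
      (∀ x : ℝ, 1 ≤ x → ‖opEval P x‖ ≤ M) → ∃ A : E →L[ℂ] E, ∀ s, opEval P s = A from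
    h _ P M le_rfl hP
  intro n
  induction n with
  | zero =>
    intro P M hn _
    rw [natDegree_eq_zero.1 (Nat.le_zero.1 hn) |>.choose_spec.symm]
    exact ⟨_, fun s => opEval_C _ s⟩
  | succ n ih =>
    intro P M hn hP
    set b := P.coeff 0
    have hdiv : ∀ s, opEval P s = s • opEval P.divX s + b := fun s => by
      rw [← opEval_mul_X, ← opEval_C b s, ← opEval_add, divX_mul_X_add]
    have hx : ∀ x : ℝ, 1 ≤ x → x * ‖opEval P.divX x‖ ≤ M + ‖b‖ := by
      intro x hx
      have h1 : (x : ℂ) • opEval P.divX x = opEval P x - b := by rw [hdiv]; abel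
      have h2 := (norm_sub_le (opEval P x) b).trans (add_le_add_left (hP x hx) ‖b‖)
      rwa [← h1, norm_smul, Complex.norm_of_nonneg (zero_le_one.trans hx)] at h2
    obtain ⟨A, hA⟩ := ih P.divX (M + ‖b‖)
      (by rw [natDegree_divX_eq_natDegree_tsub_one]; omega)
      (fun x h1 => (le_mul_of_one_le_left (norm_nonneg _) h1).trans (hx x h1))
    have hA0 : A = 0 := by
      by_contra hne
      have hpos : 0 < ‖A‖ := norm_pos_iff.2 hne
      obtain ⟨x, hx1⟩ := exists_gt (max 1 ((M + ‖b‖) / ‖A‖))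
      have h1 := hx x ((le_max_left _ _).trans hx1.le)
      rw [hA] at h1
      have h2 := (div_lt_iff₀ hpos).1 ((le_max_right _ _).trans_lt hx1)
      linarith
    exact ⟨b, fun s => by rw [hdiv, hA, hA0, smul_zero, zero_add]⟩

variable [CompleteSpace E]

/-- A rational function with poles in the open left half plane which is bounded in the right half
plane has a kernel on the positive half line: split off one pole at a time. -/
theorem hasCausalKernel_of_stable {m : Multiset ℂ} (hm : ∀ a ∈ m, a.re < 0)
    (P : Polynomial (E →L[ℂ] E)) {M : ℝ}
    (hP : ∀ s : ℂ, 0 ≤ s.re → ‖opEval P s‖ ≤ M * ‖rootProd m s‖) :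
    HasCausalKernel fun s => (rootProd m s)⁻¹ • opEval P s := by
  induction m using Multiset.induction_on generalizing P M with
  | empty =>
    obtain ⟨A, hA⟩ := opEval_const_of_bounded P (M := M) fun x hx => by
      have := hP x (by simpa using zero_le_one.trans hx)
      simpa [rootProd_zero] using this
    simpa [rootProd_zero, hA] using HasCausalKernel.const A
  | cons a m ih =>
    have ha : a.re < 0 := hm a (Multiset.mem_cons_self a m)
    have hm' : ∀ b ∈ m, b.re < 0 := fun b hb => hm b (Multiset.mem_cons_of_mem hb)
    obtain ⟨δ, hδ, hlow⟩ := exists_le_norm_rootProd hm'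
    obtain ⟨P₁, hP₁⟩ := exists_opEval_eq_add_sub_smul P a
    set b := opEval P a
    have hb : ∀ s : ℂ, 0 ≤ s.re → ‖b‖ ≤ ‖b‖ / δ * ‖rootProd m s‖ := by
      intro s hs
      rw [div_mul_eq_mul_div, le_div_iff₀ hδ]
      exact mul_le_mul_of_nonneg_left (hlow s hs) (norm_nonneg b)
    have h1 := (ih hm' (C b) (M := ‖b‖ / δ) fun s hs => by
      rw [opEval_C]; exact hb s hs).inv_sub_smul ha
    have h2 := ih hm' P₁ (M := M + ‖b‖ / δ / (-a.re)) fun s hs => by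
      have ha' : 0 < -a.re := neg_pos.2 ha
      have hsa := neg_re_le_norm_sub (a := a) hs
      have hsa0 : 0 < ‖s - a‖ := ha'.trans_le hsa
      have e1 : ‖s - a‖ * ‖opEval P₁ s‖ ≤ M * (‖s - a‖ * ‖rootProd m s‖) + ‖b‖ := by
        have e2 : (s - a) • opEval P₁ s = opEval P s - b := by rw [hP₁]; abel
        have e3 := (norm_sub_le (opEval P s) b).trans (add_le_add_left (hP s hs) ‖b‖)
        rwa [← e2, norm_smul, rootProd_cons, norm_mul] at e3
      have e4 : ‖b‖ ≤ ‖s - a‖ * (‖b‖ / δ / (-a.re) * ‖rootProd m s‖) := by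
        refine (hb s hs).trans ?_
        have : 1 ≤ ‖s - a‖ / (-a.re) := (one_le_div ha').2 hsa
        calc ‖b‖ / δ * ‖rootProd m s‖ ≤ ‖s - a‖ / (-a.re) * (‖b‖ / δ * ‖rootProd m s‖) :=
              le_mul_of_one_le_left (by positivity) this
          _ = _ := by ring
      refine le_of_mul_le_mul_left ?_ hsa0
      linarith [e1, e4]
    refine (h1.add h2).congr_of_finite (finite_singleton a) fun s hs => ?_
    have hsa : s - a ≠ 0 := sub_ne_zero.2 hs
    rw [opEval_C, hP₁ s, rootProd_cons, smul_add, mul_inv, smul_smul, smul_smul]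
    congr 2
    field_simp

/-- Zeros of the denominator in the closed right half plane cancel, as the quotient is bounded. -/
theorem hasCausalKernel_of_bounded (m m₁ : Multiset ℂ) (hm₁ : ∀ a ∈ m₁, a.re < 0)
    (P : Polynomial (E →L[ℂ] E)) {M : ℝ}
    (hP : ∀ s : ℂ, 0 ≤ s.re → ‖opEval P s‖ ≤ M * ‖rootProd (m + m₁) s‖) :
    HasCausalKernel fun s => (rootProd (m + m₁) s)⁻¹ • opEval P s := by
  induction m using Multiset.induction_on generalizing m₁ P with
  | empty =>
    rw [zero_add] at *
    exact hasCausalKernel_of_stable hm₁ P hP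
  | cons a m ih =>
    rcases lt_or_ge a.re 0 with ha | ha
    · rw [Multiset.cons_add, ← Multiset.add_cons] at *
      refine ih (a ::ₘ m₁) (fun b hb => ?_) P hP
      rcases Multiset.mem_cons.1 hb with rfl | hb
      exacts [ha, hm₁ b hb]
    · rw [Multiset.cons_add] at *
      obtain ⟨P₁, hP₁⟩ := exists_opEval_eq_add_sub_smul P a
      have hPa : opEval P a = 0 := by
        have := hP a ha
        rw [rootProd_cons, sub_self, zero_mul, norm_zero, mul_zero] at this
        exact norm_le_zero_iff.1 this
      simp only [hPa, zero_add] at hP₁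
      have h1 := ih m₁ hm₁ P₁ fun s hs => by
        refine le_of_le_off_finite (f := fun s => ‖opEval P₁ s‖)
          (g := fun s => M * ‖rootProd (m + m₁) s‖) (continuous_opEval P₁).norm
          (continuous_const.mul (continuous_rootProd _).norm) (finite_singleton a)
          (fun z hz hza => ?_) hs
        have hza' : 0 < ‖z - a‖ := norm_pos_iff.2 (sub_ne_zero.2 hza)
        have e := hP z hz.le
        rw [hP₁, norm_smul, rootProd_cons, norm_mul, mul_left_comm] at e
        exact le_of_mul_le_mul_left e hza'
      refine h1.congr_of_finite (finite_singleton a) fun s hs => ?_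
      have hsa : s - a ≠ 0 := sub_ne_zero.2 hs
      rw [hP₁ s, rootProd_cons, mul_inv, smul_smul]
      congr 1
      field_simp

/-- The bound on `V` carries over to its fraction, except at the finitely many zeros of the
denominator, and is extended to those by continuity. -/
theorem IsRational.hasCausalKernel {V : ℂ → E →L[ℂ] E} (hV : IsRational V) {M : ℝ}
    (hM : ∀ s : ℂ, 0 < s.re → ‖V s‖ ≤ M) : HasCausalKernel V := by
  obtain ⟨q, P, hq, hVq⟩ := hV
  set c := q.leadingCoeff
  have hc : c ≠ 0 := leadingCoeff_ne_zero.2 hq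
  have hqr : ∀ s, q.eval s = c * rootProd q.roots s := fun s =>
    (IsAlgClosed.splits q).eval_eq_prod_roots s
  have hfin : {s : ℂ | q.eval s = 0}.Finite := by
    refine (q.roots.toFinset.finite_toSet).subset fun s hs => ?_
    simpa [hq] using hs
  let P' : Polynomial (E →L[ℂ] E) := C (c⁻¹ • ContinuousLinearMap.id ℂ E) * P
  have hP' : ∀ s, opEval P' s = c⁻¹ • opEval P s := fun s => by
    rw [opEval_C_mul, ContinuousLinearMap.smul_comp, ContinuousLinearMap.id_comp]
  have hV' : ∀ s ∉ {s : ℂ | q.eval s = 0}, V s = (rootProd (q.roots + 0) s)⁻¹ • opEval P' s := by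
    intro s hs
    rw [hVq s hs, hqr, hP', smul_smul, mul_inv_rev, add_zero]
    rfl
  refine (hasCausalKernel_of_bounded q.roots 0 (by simp) P' (M := M) fun s hs => ?_).congr_of_finite
    hfin hV'
  refine le_of_le_off_finite (f := fun s => ‖opEval P' s‖)
    (g := fun s => M * ‖rootProd (q.roots + 0) s‖) (continuous_opEval P').norm
    (continuous_const.mul (continuous_rootProd _).norm) hfin (fun z hz hzq => ?_) hs
  have hne : rootProd (q.roots + 0) z ≠ 0 := by
    rw [add_zero]
    intro h0
    exact hzq (by rw [mem_ofPred_eq, hqr, h0, mul_zero])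
  have h1 := hM z hz
  rw [hV' z hzq, norm_smul, norm_inv] at h1
  rwa [inv_mul_le_iff₀ (norm_pos_iff.2 hne), mul_comm] at h1

end Rational

section BiInner

open ContinuousLinearMap

/-! ### Bi-inner functions -/

variable {E : Type*} [NormedAddCommGroup E] [InnerProductSpace ℂ E] [CompleteSpace E]

theorem tilde_unitary_boundary {V : ℂ → E →L[ℂ] E}
    (hV : ∀ᵐ ω : ℝ, V (ω * Complex.I) ∈ unitary (E →L[ℂ] E)) :
    ∀ᵐ ω : ℝ, tilde V (ω * Complex.I) ∈ unitary (E →L[ℂ] E) := by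
  filter_upwards [ae_neg hV] with ω hω
  have h1 : conj ((ω : ℂ) * Complex.I) = ((-ω : ℝ) : ℂ) * Complex.I := by
    rw [map_mul, Complex.conj_ofReal, Complex.conj_I, Complex.ofReal_neg, mul_neg, neg_mul]
  rw [tilde, h1]
  exact Unitary.star_mem hω

theorem IsBiInner.hasCausalKernel {V : ℂ → E →L[ℂ] E} (hV : IsBiInner V) (hr : IsRational V) :
    HasCausalKernel V :=
  hr.hasCausalKernel hV.bounded.choose_spec

namespace HasCausalKernel

variable {V : ℂ → E →L[ℂ] E}

theorem existsUnique_wienerHopf (h : HasCausalKernel V) : ∃! T, IsWienerHopfOperator V T := by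
  obtain ⟨D, θ, h1, -⟩ := h
  exact h1.existsUnique_wienerHopf

theorem existsUnique_hankel (h : HasCausalKernel V) : ∃! H, IsHankelOperator V H := by
  obtain ⟨D, θ, h1, h2⟩ := h
  exact h1.existsUnique_hankel h2

theorem wienerHopf_eq (h : HasCausalKernel V) : wienerHopf V = toeplitz V := by
  obtain ⟨D, θ, h1, -⟩ := h
  exact h1.wienerHopf_eq

theorem hankel_eq (h : HasCausalKernel V) : hankel V = hankelCompression V := by
  obtain ⟨D, θ, h1, h2⟩ := h
  exact h1.hankel_eq h2

theorem memLp_axis (h : HasCausalKernel V) : MemLp (axis V) ⊤ (volume : Measure ℝ) := by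
  obtain ⟨D, θ, h1, -⟩ := h
  exact h1.memLp_axis

theorem adjoint_wienerHopf_comp (h : HasCausalKernel V)
    (hV : ∀ᵐ ω : ℝ, V (ω * Complex.I) ∈ unitary (E →L[ℂ] E)) :
    adjoint (wienerHopf V) ∘L wienerHopf V = ContinuousLinearMap.id ℂ _ := by
  rw [h.wienerHopf_eq]
  obtain ⟨D, θ, h1, h2⟩ := h
  exact h1.adjoint_toeplitz_comp h2 hV

/-- `[T_V H_V|𝔥(Ṽ)] : L²₊(E) ⊕ 𝔥(Ṽ) → L²₊(E)` is unitary. -/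
theorem complementary (h : HasCausalKernel V)
    (hV : ∀ᵐ ω : ℝ, V (ω * Complex.I) ∈ unitary (E →L[ℂ] E)) :
    (∀ f, adjoint (hankel V) f ∈ modelSpace (WienerHopf.tilde V)) ∧
      hankel V ∘L (modelSpace (WienerHopf.tilde V)).starProjection = hankel V ∧
      IsUnitaryRow (wienerHopf V) (hankelRes V) := by
  refine isUnitaryRow_of_complementary (h.adjoint_wienerHopf_comp hV)
    (h.tilde.adjoint_wienerHopf_comp (tilde_unitary_boundary hV)) ?_ ?_
  · rw [h.wienerHopf_eq, h.hankel_eq]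
    exact toeplitz_add_hankel h.memLp_axis hV
  · rw [h.tilde.wienerHopf_eq, h.hankel_eq]
    exact hankel_add_toeplitz_tilde h.memLp_axis hV

end HasCausalKernel

theorem adjoint_hankelRes (V : ℂ → E →L[ℂ] E) : adjoint (hankelRes V) = hankelAdj V := by
  rw [hankelRes, adjoint_comp, Submodule.adjoint_subtypeL]
  rfl

theorem adjoint_compressY (V W : ℂ → E →L[ℂ] E) : adjoint (compressY V W) = compressY W V := by
  rw [compressY, adjoint_comp, Submodule.adjoint_subtypeL,
    Submodule.adjoint_orthogonalProjectionOnto]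
  rfl

theorem norm_compressY_le (V W : ℂ → E →L[ℂ] E) : ‖compressY V W‖ ≤ 1 := by
  refine opNorm_le_bound _ zero_le_one fun x => ?_
  rw [one_mul]
  exact Submodule.norm_orthogonalProjectionOnto_apply_le _ (x : L2Plus E)

/-- `T_R = T_V T_W* + H_V Y H_W*`. -/
theorem wienerHopf_symbolVW_eq_dilate {V W : ℂ → E →L[ℂ] E} (hV : HasCausalKernel V)
    (hW : HasCausalKernel W) (hVu : ∀ᵐ ω : ℝ, V (ω * Complex.I) ∈ unitary (E →L[ℂ] E))
    (hWu : ∀ᵐ ω : ℝ, W (ω * Complex.I) ∈ unitary (E →L[ℂ] E)) :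
    wienerHopf (symbolVW V W) = IsUnitaryRow.dilate (wienerHopf V) (hankelRes V) (wienerHopf W)
      (hankelRes W) (compressY V W) := by
  have hR : wienerHopf (symbolVW V W) = toeplitz (symbolVW V W) := by
    obtain ⟨D, θ, h1, -⟩ := hV
    obtain ⟨D', θ', h1', -⟩ := hW
    obtain ⟨D'', r, hr⟩ := h1.symbolVW h1'
    exact hr.wienerHopf_eq
  obtain ⟨-, hPV, -⟩ := hV.complementary hVu
  obtain ⟨hmW, -, -⟩ := hW.complementary hWu
  rw [hR, toeplitz_symbolVW hV.memLp_axis hW.memLp_axis, ← hV.wienerHopf_eq, ← hW.wienerHopf_eq,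
    ← hV.hankel_eq, ← hW.hankel_eq]
  ext1 f
  rw [IsUnitaryRow.dilate_apply, adjoint_hankelRes]
  -- On the right, `H_V P_{𝔥(Ṽ)} P_{𝔥(W̃)} H_W* = H_V H_W*`.
  have h1 : ((modelSpace (tilde W)).starProjection (adjoint (hankel W) f) : L2Plus E) =
      adjoint (hankel W) f := Submodule.starProjection_eq_self_iff.2 (hmW f)
  change _ + hankel V (adjoint (hankel W) f) = _ + (hankel V ∘L
    (modelSpace (tilde V)).starProjection)
      ((modelSpace (tilde W)).starProjection (adjoint (hankel W) f))
  rw [hPV, h1]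
  rfl

end BiInner

end WienerHopf

end

open WienerHopf ContinuousLinearMap in
theorem proposition4p1 {E : Type*} [NormedAddCommGroup E] [InnerProductSpace ℂ E]
    [CompleteSpace E] [FiniteDimensional ℂ E] (V W : ℂ → E →L[ℂ] E)
    (hV : IsRational V) (hW : IsRational W) (hVi : IsBiInner V) (hWi : IsBiInner W) :
    let R := symbolVW V W
    let TR := wienerHopf R
    let TV := wienerHopf V
    let TW := wienerHopf W
    let Y := compressY V W
    -- the operators in play are well defined
    (∀ Θ ∈ ({V, W, tilde V, tilde W, R} : Set (ℂ → E →L[ℂ] E)), ∃! T, IsWienerHopfOperator Θ T) ∧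
    (∀ Θ ∈ ({V, W} : Set (ℂ → E →L[ℂ] E)), ∃! H, IsHankelOperator Θ H) ∧
    (∀ f, adjoint (hankel V) f ∈ modelSpace (tilde V)) ∧
    (∀ f, adjoint (hankel W) f ∈ modelSpace (tilde W)) ∧
    ‖Y‖ ≤ 1 ∧
    -- the decomposition of `T_R`
    TR = TV ∘L adjoint TW + hankelRes V ∘L Y ∘L hankelAdj W ∧
    -- invertibility
    (TR.IsInvertible ↔ Y.IsInvertible) ∧
    (Y.IsInvertible →
      TR.inverse = TW ∘L adjoint TV + hankelRes W ∘L Y.inverse ∘L hankelAdj V) ∧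
    -- the kernel of `T_R`
    Module.rank ℂ (LinearMap.ker TR.toLinearMap) = Module.rank ℂ (LinearMap.ker Y.toLinearMap) ∧
    LinearMap.ker TR.toLinearMap =
      (LinearMap.ker Y.toLinearMap).map (hankelRes W).toLinearMap ∧
    (LinearMap.ker Y.toLinearMap).map (modelSpace (tilde W)).subtype =
      LinearMap.range (wienerHopf (tilde V)).toLinearMap ⊓ modelSpace (tilde W) ∧
    -- the kernel of `T_R*`
    Module.rank ℂ (LinearMap.ker (adjoint TR).toLinearMap) =
      Module.rank ℂ (LinearMap.ker (adjoint Y).toLinearMap) ∧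
    LinearMap.ker (adjoint TR).toLinearMap =
      (LinearMap.ker (adjoint Y).toLinearMap).map (hankelRes V).toLinearMap ∧
    (LinearMap.ker (adjoint Y).toLinearMap).map (modelSpace (tilde V)).subtype =
      LinearMap.range (wienerHopf (tilde W)).toLinearMap ⊓ modelSpace (tilde V) ∧
    -- the orthogonal complements of the ranges
    Module.rank ℂ ((LinearMap.range TR.toLinearMap)ᗮ : Submodule ℂ (L2Plus E)) =
      Module.rank ℂ ((LinearMap.range Y.toLinearMap)ᗮ : Submodule ℂ (modelSpace (tilde V))) ∧
    (LinearMap.range TR.toLinearMap)ᗮ = LinearMap.ker (adjoint TR).toLinearMap ∧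
    (LinearMap.range TR.toLinearMap)ᗮ =
      (LinearMap.range Y.toLinearMap)ᗮ.map (hankelRes V).toLinearMap ∧
    -- Moore-Penrose inverses
    (HasMoorePenrose TR ↔ HasMoorePenrose Y) ∧
    (∀ (hT : HasMoorePenrose TR) (hY : HasMoorePenrose Y),
      moorePenrose TR hT =
        TW ∘L adjoint TV + hankelRes W ∘L moorePenrose Y hY ∘L hankelAdj V) := by

  intro R TR TV TW Y
  have kV := hVi.hasCausalKernel hV
  have kW := hWi.hasCausalKernel hW
  obtain ⟨mV, -, uV⟩ := kV.complementary hVi.unitary_boundary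
  obtain ⟨mW, -, uW⟩ := kW.complementary hWi.unitary_boundary
  have iV := kV.tilde.adjoint_wienerHopf_comp (tilde_unitary_boundary hVi.unitary_boundary)
  have iW := kW.tilde.adjoint_wienerHopf_comp (tilde_unitary_boundary hWi.unitary_boundary)
  have hTR : TR = IsUnitaryRow.dilate TV (hankelRes V) TW (hankelRes W) Y :=
    wienerHopf_symbolVW_eq_dilate kV kW hVi.unitary_boundary hWi.unitary_boundary
  have hTRa : adjoint TR = IsUnitaryRow.dilate TW (hankelRes W) TV (hankelRes V) (adjoint Y) := by
    rw [hTR, IsUnitaryRow.adjoint_dilate]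
  have kerT : LinearMap.ker TR.toLinearMap =
      (LinearMap.ker Y.toLinearMap).map (hankelRes W).toLinearMap := by
    rw [hTR]; exact uV.ker_dilate uW Y
  have kerTa : LinearMap.ker (adjoint TR).toLinearMap =
      (LinearMap.ker (adjoint Y).toLinearMap).map (hankelRes V).toLinearMap := by
    rw [hTRa]; exact uW.ker_dilate uV (adjoint Y)
  have rankT : Module.rank ℂ (LinearMap.ker TR.toLinearMap) =
      Module.rank ℂ (LinearMap.ker Y.toLinearMap) := by
    rw [kerT]; exact (Submodule.equivMapOfInjective _ uW.injective _).rank_eq.symm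
  have rankTa : Module.rank ℂ (LinearMap.ker (adjoint TR).toLinearMap) =
      Module.rank ℂ (LinearMap.ker (adjoint Y).toLinearMap) := by
    rw [kerTa]; exact (Submodule.equivMapOfInjective _ uV.injective _).rank_eq.symm
  have orthT : (LinearMap.range TR.toLinearMap)ᗮ = LinearMap.ker (adjoint TR).toLinearMap :=
    orthogonal_range TR
  have orthY : (LinearMap.range Y.toLinearMap)ᗮ = LinearMap.ker (adjoint Y).toLinearMap :=
    orthogonal_range Y
  refine ⟨?_, ?_, mV, mW, norm_compressY_le V W, ?_, ?_, ?_, rankT, kerT, ?_, rankTa, kerTa, ?_,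
    ?_, orthT, ?_, ?_, ?_⟩
  · rintro Θ (rfl | rfl | rfl | rfl | rfl)
    · exact kV.existsUnique_wienerHopf
    · exact kW.existsUnique_wienerHopf
    · exact kV.tilde.existsUnique_wienerHopf
    · exact kW.tilde.existsUnique_wienerHopf
    · obtain ⟨D, θ, h1, -⟩ := kV
      obtain ⟨D', θ', h1', -⟩ := kW
      obtain ⟨D'', r, hr⟩ := h1.symbolVW h1'
      exact hr.existsUnique_wienerHopf
  · rintro Θ (rfl | rfl)
    · exact kV.existsUnique_hankel
    · exact kW.existsUnique_hankel
  · rw [hTR, ← adjoint_hankelRes]; rfl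
  · rw [hTR]; exact uV.dilate_isInvertible_iff uW Y
  · intro hY
    rw [hTR, ← adjoint_hankelRes]
    exact uV.dilate_inverse_of_isInvertible uW Y hY
  · exact map_ker_compression iV _
  · rw [adjoint_compressY]
    exact map_ker_compression iW _
  · rw [orthT, orthY]; exact rankTa
  · rw [orthT, orthY]; exact kerTa
  · rw [hTR]; exact uV.hasMoorePenrose_dilate_iff uW Y
  · intro hT hY
    rw [← adjoint_hankelRes]
    revert hT
    rw [hTR]
    intro hT
    exact uV.moorePenrose_dilate uW Y hT hY
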